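/- Let $\mathcal L\subset\mathbb R^d$ be a lattice, $\Lambda\subset\mathcal L$ any (finite or infinite) subset, and $J=(J_{xy})_{x,y\in\Lambda}$ a Hermitian matrix of complex numbers with $\sup_{x\in\Lambda}|J_{xx}|<\infty$. On the bosonic Fock space $\mathcal F=\bigoplus_{m\ge 0}\otimes_s^m\ell^2(\mathcal L)$, with the usual annihilation and creation operators $b_x,b_x^*$ and $n_x=b_x^*b_x$, consider for $g>0$, $\mu\in\mathbb R$ the Bose-Hubbard Hamiltonian $$H=-\sum_{x,y\in\Lambda}J_{xy}b_x^*b_y+\frac g2\sum_{x\in\Lambda}n_x(n_x-1)-\mu\sum_{x\in\Lambda}n_x ,$$ the direct sum of its restrictions to the $m$-particle spaces, which are bounded and self-adjoint under the hypotheses. Let $N=\sum_{x\in\Lambda}n_x$ and, for $S\subset\Lambda$, let $\mathrm d\Gamma(\chi_S)=\sum_{x\in S}n_x$ be the number of particles in $S$, with expectations $\langle\phi,\mathrm d\Gamma(\chi_S)\phi\rangle$ understood as quadratic forms. Set $\kappa_J^{(q)}=\sup_{x\in\Lambda}\sum_{y\in\Lambda}|J_{xy}||x-y|^q$ and $\kappa=\kappa_J^{(1)}$.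 Suppose that $\kappa_J^{(p)}<\infty$ for some integer $p\ge1$. Let $c>\kappa$ and let $0\le n\le p-1$ be an integer. Then for all $B>0$ and $\theta\in(0,1)$ there is a constant $C_n>0$, depending only on $n,c,\Lambda,J,B,\theta$, such that for all $g>0$, $\mu\in\mathbb R$, $\phi\in\mathcal D(N^{1/2})$, $0<b\le\max\{B,\theta\rho\}$, $t>0$ and $\rho>b+ct$, $$\langle e^{-itH}\phi,\mathrm d\Gamma(\chi_{|x|>\rho})e^{-itH}\phi\rangle\le\langle\phi,\mathrm d\Gamma(\chi_{|x|>b})\phi\rangle+C_n\rho^{-n}\langle\phi,N\phi\rangle,$$ $$\langle e^{-itH}\phi,\mathrm d\Gamma(\chi_{|x|<b})e^{-itH}\phi\rangle\le\langle\phi,\mathrm d\Gamma(\chi_{|x|<\rho})\phi\rangle+C_n\rho^{-n}\langle\phi,N\phi\rangle .$$ In particular (take $B=b$), for every fixed $b>0$ both bounds hold for all $t>0$ and $\rho>b+ct$ with a constant $C_n$ that does not depend on $t$, $\rho$ or $\phi$. -/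

import Mathlib

open scoped ENNReal

namespace BoseHubbard

noncomputable section

/-! ### Creation and annihilation operators on sequences of `n`-particle wave functions -/

/-- Sequences `(ψ₀, ψ₁, ψ₂, …)` of complex functions `ψ n` of `n` points of `S`. -/
abbrev Wave (S : Type*) := (n : ℕ) → (Fin n → S) → ℂ

/-- The annihilation operator at the site `x`:
`(b_x ψ)_n (x₁, …, x_n) = √(n + 1) ψ_{n + 1} (x, x₁, …, x_n)`. -/
def annih {S : Type*} (x : S) (ψ : Wave S) : Wave S :=
  fun n v => ((√((n : ℝ) + 1) : ℝ) : ℂ) * ψ (n + 1) (Fin.cons x v)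

open Classical in
/-- The creation operator at the site `x`:
`(b*_x ψ)_n (x₁, …, x_n) = n^{-1/2} ∑ᵢ δ_{x, xᵢ} ψ_{n - 1} (x₁, …, x̂ᵢ, …, x_n)`, and
`(b*_x ψ)_0 = 0`. -/
def create {S : Type*} (x : S) (ψ : Wave S) : Wave S
  | 0, _ => 0
  | n + 1, v => (((√((n : ℝ) + 1))⁻¹ : ℝ) : ℂ) *
      ∑ i : Fin (n + 1), if v i = x then ψ n (i.removeNth v) else 0

/-- The number operator `n_x = b*_x b_x` at the site `x`. -/
def num {S : Type*} (x : S) (ψ : Wave S) : Wave S := create x (annih x ψ)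

/-- The expression
`H ψ = - ∑_{x, y ∈ Λ} J_{xy} b*_x b_y ψ + (g / 2) ∑_{x ∈ Λ} n_x (n_x - 1) ψ - μ ∑_{x ∈ Λ} n_x ψ`,
evaluated at each configuration of particles. At a given configuration only the finitely many
occupied sites `x` contribute. -/
def hamExpr {S : Type*} (Λ : Set S) (J : Λ → Λ → ℂ) (g μ : ℝ) (ψ : Wave S) : Wave S :=
  fun n v =>
    -(∑' x : Λ, ∑' y : Λ, J x y * create (x : S) (annih (y : S) ψ) n v)
      + ((g / 2 : ℝ) : ℂ) * (∑' x : Λ, (num (x : S) (num (x : S) ψ) n v - num (x : S) ψ n v))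
      - (μ : ℂ) * (∑' x : Λ, num (x : S) ψ n v)

/-! ### The bosonic Fock space over `ℓ²(S)` -/

/-- The symmetric functions in `ℓ²(Sⁿ)`. -/
def symmFun (S : Type*) (n : ℕ) : Submodule ℂ (lp (fun _ : Fin n → S => ℂ) 2) where
  carrier := {φ | ∀ (σ : Equiv.Perm (Fin n)) (v : Fin n → S), φ (v ∘ σ) = φ v}
  add_mem' := by
    intro a b ha hb σ v
    simp only [lp.coeFn_add, Pi.add_apply, ha σ v, hb σ v]
  zero_mem' := by
    intro σ v
    simp
  smul_mem' := by
    intro c a ha σ v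
    simp only [lp.coeFn_smul, Pi.smul_apply, ha σ v]

theorem isClosed_symmFun (S : Type*) (n : ℕ) :
    IsClosed (symmFun S n : Set (lp (fun _ : Fin n → S => ℂ) 2)) := by
  have hc : ∀ v : Fin n → S, Continuous fun φ : lp (fun _ : Fin n → S => ℂ) 2 => φ v :=
    fun v => (lp.lipschitzWith_one_eval (E := fun _ : Fin n → S => ℂ) 2 v).continuous
  have h : (symmFun S n : Set (lp (fun _ : Fin n → S => ℂ) 2)) =
      ⋂ (σ : Equiv.Perm (Fin n)) (v : Fin n → S), {φ | φ (v ∘ σ) = φ v} := by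
    ext φ
    simp only [Set.mem_iInter]
    rfl
  rw [h]
  exact isClosed_iInter fun σ => isClosed_iInter fun v => isClosed_eq (hc _) (hc _)

/-- The `n`-particle space, the `n`-fold symmetric tensor power of `ℓ²(S)`: the Hilbert space of
symmetric functions in `ℓ²(Sⁿ)`. -/
def Sector (S : Type*) (n : ℕ) : Type _ := symmFun S n

instance (S : Type*) (n : ℕ) : NormedAddCommGroup (Sector S n) :=
  inferInstanceAs (NormedAddCommGroup (symmFun S n))

instance (S : Type*) (n : ℕ) : InnerProductSpace ℂ (Sector S n) :=
  inferInstanceAs (InnerProductSpace ℂ (symmFun S n))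

instance (S : Type*) (n : ℕ) : CompleteSpace (Sector S n) :=
  (isClosed_symmFun S n).completeSpace_coe

/-- The function of `n` points that an `n`-particle vector is. -/
def Sector.toFun {S : Type*} {n : ℕ} (φ : Sector S n) (v : Fin n → S) : ℂ :=
  (show symmFun S n from φ).1 v

/-- The bosonic Fock space over `ℓ²(S)`: the Hilbert space direct sum of all `n`-particle
spaces. -/
abbrev Fock (S : Type*) := lp (fun n : ℕ => Sector S n) 2

/-- The wave functions of a vector of the Fock space. -/
def fockWave {S : Type*} (φ : Fock S) : Wave S := fun n => (φ n).toFun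

/-- The wave functions of an `n`-particle vector: zero in all sectors other than the `n`-th. -/
def sectorWave {S : Type*} {n : ℕ} (φ : Sector S n) : Wave S := Pi.single n φ.toFun

/-! ### The Hamiltonian and the time evolution -/

open Classical in
/-- The restriction `H_n` of the Hamiltonian to the `n`-particle space: the bounded self-adjoint
operator given by the expression for `H`. It exists as soon as `J` is Hermitian with uniformly
bounded row sums (`sectorHam_apply` below), and it is then unique. -/
def sectorHam {S : Type*} (Λ : Set S) (J : Λ → Λ → ℂ) (g μ : ℝ) (n : ℕ) :
    Sector S n →L[ℂ] Sector S n :=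
  if h : ∃ A : Sector S n →L[ℂ] Sector S n, IsSelfAdjoint A ∧
      ∀ (φ : Sector S n) (v : Fin n → S),
        (A φ).toFun v = hamExpr Λ J g μ (sectorWave φ) n v
  then h.choose else 0

theorem isSelfAdjoint_sectorHam {S : Type*} (Λ : Set S) (J : Λ → Λ → ℂ) (g μ : ℝ) (n : ℕ) :
    IsSelfAdjoint (sectorHam Λ J g μ n) := by
  unfold sectorHam
  split_ifs with h
  · exact h.choose_spec.1
  · exact IsSelfAdjoint.zero (Sector S n →L[ℂ] Sector S n)

/-- The operator `exp (-i t H_n)` on the `n`-particle space (exponential of a bounded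
operator). -/
def sectorEvol {S : Type*} (Λ : Set S) (J : Λ → Λ → ℂ) (g μ t : ℝ) (n : ℕ) :
    Sector S n →L[ℂ] Sector S n :=
  NormedSpace.exp ((-(Complex.I * (t : ℂ))) • sectorHam Λ J g μ n)

theorem exp_mem_unitary {R : Type*} [NormedRing R] [NormedAlgebra ℂ R] [StarRing R]
    [ContinuousStar R] [CompleteSpace R] [StarModule ℂ R] {a : R} (ha : IsSelfAdjoint a)
    (t : ℝ) : NormedSpace.exp ((-(Complex.I * (t : ℂ))) • a) ∈ unitary R := by
  let +nondep : NormedAlgebra ℚ R := .restrictScalars ℚ ℂ R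
  apply NormedSpace.exp_mem_unitary_of_mem_skewAdjoint
  rw [skewAdjoint.mem_iff, star_smul, ha.star_eq, ← neg_smul]
  simp

theorem norm_sectorEvol {S : Type*} (Λ : Set S) (J : Λ → Λ → ℂ) (g μ t : ℝ) (n : ℕ)
    (φ : Sector S n) : ‖sectorEvol Λ J g μ t n φ‖ = ‖φ‖ :=
  ContinuousLinearMap.norm_map_of_mem_unitary
    (exp_mem_unitary (isSelfAdjoint_sectorHam Λ J g μ n) t) φ

/-- The unitary evolution `exp (-i t H)` on the Fock space, where `H` is the direct sum of the
operators `H_n`. -/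
def evol {S : Type*} (Λ : Set S) (J : Λ → Λ → ℂ) (g μ t : ℝ) (φ : Fock S) : Fock S :=
  ⟨fun n => sectorEvol Λ J g μ t n (φ n), by
    have h := (lp.memℓp φ).summable (by norm_num)
    refine memℓp_gen ?_
    simpa only [norm_sectorEvol] using h⟩

/-! ### Particle numbers -/

/-- The quadratic form `⟨φ, dΓ(χ_A) φ⟩ = ∑_{x ∈ A} ⟨φ, b*_x b_x φ⟩ = ∑_{x ∈ A} ‖b_x φ‖²`, the
expected number of particles in the set of sites `A`; it takes the value `∞` outside of its form
domain. -/
def particles {S : Type*} (A : Set S) (φ : Fock S) : ℝ≥0∞ :=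
  ∑' x : A, ∑' n : ℕ, ∑' v : Fin n → S, ‖annih (x : S) (fockWave φ) n v‖ₑ ^ 2

/-- `φ ∈ D(N^{1/2})` for the number operator `N = ∑_{x ∈ Λ} n_x`. -/
def MemDomSqrtN {S : Type*} (Λ : Set S) (φ : Fock S) : Prop := particles Λ φ < ∞

/-- `κ_J^{(p)} = sup_{x ∈ Λ} ∑_{y ∈ Λ} |J_{xy}| |x - y|^p`, with values in `[0, ∞]`. -/
def kappa {S : Type*} [PseudoEMetricSpace S] (Λ : Set S) (J : Λ → Λ → ℂ) (p : ℕ) : ℝ≥0∞ :=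
  ⨆ x : Λ, ∑' y : Λ, ‖J x y‖ₑ * edist (x : S) (y : S) ^ p

/-! ### Well-definedness of `H_n`: for Hermitian `J` with bounded row sums, `sectorHam` is given
by the expression for `H` -/

/-- A Hermitian kernel with uniformly bounded absolute row sums defines a bounded self-adjoint
operator (Schur test). -/
theorem exists_schur {I : Type*} (M : I → I → ℂ) (hM : ∀ v w, M w v = star (M v w)) (C : ℝ)
    (hs : ∀ v, Summable fun w => ‖M v w‖) (hC : ∀ v, ∑' w, ‖M v w‖ ≤ C) :
    ∃ A : lp (fun _ : I => ℂ) 2 →L[ℂ] lp (fun _ : I => ℂ) 2, IsSelfAdjoint A ∧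
      ∀ f v, A f v = ∑' w, M v w * f w := by
  classical
  have hb : ∀ (f : lp (fun _ : I => ℂ) 2) w, ‖f w‖ ≤ ‖f‖ :=
    fun f w => lp.norm_apply_le_norm (by norm_num) f w
  have hsum : ∀ (f : lp (fun _ : I => ℂ) 2) v, Summable fun w => ‖M v w‖ * ‖f w‖ := fun f v =>
    Summable.of_nonneg_of_le (fun w => by positivity)
      (fun w => mul_le_mul_of_nonneg_left (hb f w) (norm_nonneg _)) ((hs v).mul_right ‖f‖)
  have hsum2 : ∀ (f : lp (fun _ : I => ℂ) 2) v, Summable fun w => ‖M v w‖ * ‖f w‖ ^ 2 :=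
    fun f v => Summable.of_nonneg_of_le (fun w => by positivity)
      (fun w => mul_le_mul_of_nonneg_left (pow_le_pow_left₀ (norm_nonneg _) (hb f w) 2)
        (norm_nonneg _)) ((hs v).mul_right (‖f‖ ^ 2))
  have hsumc : ∀ (f : lp (fun _ : I => ℂ) 2) v, Summable fun w => M v w * f w := fun f v =>
    Summable.of_norm (by simpa only [norm_mul] using hsum f v)
  have hsq : ∀ f : lp (fun _ : I => ℂ) 2, HasSum (fun w => ‖f w‖ ^ 2) (‖f‖ ^ 2) := by
    intro f
    have := lp.hasSum_norm (p := 2) (by norm_num) f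
    simpa using this
  have hcol : ∀ (s : Finset I) w, ∑ v ∈ s, ‖M v w‖ ≤ C := by
    intro s w
    have h1 : ∀ v, ‖M v w‖ = ‖M w v‖ := fun v => by rw [hM v w, norm_star]
    simp only [h1]
    exact ((hs w).sum_le_tsum s (fun _ _ => norm_nonneg _)).trans (hC w)
  have hpt : ∀ (f : lp (fun _ : I => ℂ) 2) v,
      ‖∑' w, M v w * f w‖ ^ 2 ≤ C * ∑' w, ‖M v w‖ * ‖f w‖ ^ 2 := by
    intro f v
    have hC0 : 0 ≤ C := (tsum_nonneg fun _ => norm_nonneg _).trans (hC v)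
    set X := ∑' w, ‖M v w‖ * ‖f w‖ with hX
    set Y := ∑' w, ‖M v w‖ * ‖f w‖ ^ 2 with hY
    have hY0 : 0 ≤ Y := tsum_nonneg fun _ => by positivity
    have hX0 : 0 ≤ X := tsum_nonneg fun _ => by positivity
    have h1 : ‖∑' w, M v w * f w‖ ≤ X := by
      refine (norm_tsum_le_tsum_norm (by simpa only [norm_mul] using hsum f v)).trans ?_
      simp only [norm_mul]; rfl
    have h2 : ∀ s : ℝ, 2 * s * X ≤ s ^ 2 * C + Y := by
      intro s
      have h3 : 2 * s * X ≤ s ^ 2 * (∑' w, ‖M v w‖) + Y := by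
        rw [hX, hY, ← tsum_mul_left, ← tsum_mul_left,
          ← ((hs v).mul_left _).tsum_add (hsum2 f v)]
        refine ((hsum f v).mul_left _).tsum_le_tsum (fun w => ?_)
          (((hs v).mul_left _).add (hsum2 f v))
        nlinarith [mul_nonneg (norm_nonneg (M v w)) (sq_nonneg (s - ‖f w‖))]
      nlinarith [mul_le_mul_of_nonneg_left (hC v) (sq_nonneg s)]
    have h4 : X ^ 2 ≤ C * Y := by
      rcases hC0.eq_or_lt with h | h
      · have := h2 (Y + 1)
        have h5 := h2 X
        rw [← h] at h5 this ⊢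
        by_contra hcon
        have hXp : 0 < X := by
          rcases hX0.eq_or_lt with h6 | h6
          · exfalso; apply hcon; rw [← h6]; simp
          · exact h6
        have := h2 ((Y + 1) / X)
        rw [← h] at this
        have h7 : 2 * ((Y + 1) / X) * X = 2 * (Y + 1) := by field_simp
        rw [h7] at this
        linarith
      · have := h2 (X / C)
        have h7 : 2 * (X / C) * X = 2 * X ^ 2 / C := by field_simp
        have h8 : (X / C) ^ 2 * C = X ^ 2 / C := by field_simp
        rw [h7, h8] at this
        have h9 : X ^ 2 / C ≤ Y := by
          have : 2 * X ^ 2 / C = X ^ 2 / C + X ^ 2 / C := by ring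
          linarith
        rw [div_le_iff₀ h] at h9
        linarith
    exact (pow_le_pow_left₀ (norm_nonneg _) h1 2).trans h4
  have hfin : ∀ (f : lp (fun _ : I => ℂ) 2) (s : Finset I),
      ∑ v ∈ s, ‖∑' w, M v w * f w‖ ^ 2 ≤ C * (C * ‖f‖ ^ 2) := by
    intro f s
    rcases s.eq_empty_or_nonempty with rfl | ⟨v₀, -⟩
    · simp only [Finset.sum_empty]
      rcases isEmpty_or_nonempty I with h | ⟨⟨v₀⟩⟩
      · have : f = 0 := lp.eq_zero' f
        simp [this]
      · have hC0 : 0 ≤ C := (tsum_nonneg fun _ => norm_nonneg _).trans (hC v₀)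
        positivity
    have hC0 : 0 ≤ C := (tsum_nonneg fun _ => norm_nonneg _).trans (hC v₀)
    refine (Finset.sum_le_sum fun v _ => hpt f v).trans ?_
    rw [← Finset.mul_sum]
    refine mul_le_mul_of_nonneg_left ?_ hC0
    rw [← Summable.tsum_finsetSum fun v _ => hsum2 f v, ← (hsq f).tsum_eq, ← tsum_mul_left]
    refine Summable.tsum_le_tsum (fun w => ?_) (summable_sum fun v _ => hsum2 f v)
      ((hsq f).summable.mul_left _)
    rw [← Finset.sum_mul]
    exact mul_le_mul_of_nonneg_right (hcol s w) (by positivity)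
  have hmem : ∀ f : lp (fun _ : I => ℂ) 2,
      Memℓp (fun v => (∑' w, M v w * f w : ℂ)) 2 := fun f =>
    memℓp_gen' (C := C * (C * ‖f‖ ^ 2)) fun s => by simpa using hfin f s
  let T : lp (fun _ : I => ℂ) 2 →ₗ[ℂ] lp (fun _ : I => ℂ) 2 :=
    { toFun := fun f => ⟨fun v => ∑' w, M v w * f w, hmem f⟩
      map_add' := by
        intro f g
        ext v
        simp only [lp.coeFn_add, Pi.add_apply, mul_add]
        exact (hsumc f v).tsum_add (hsumc g v)
      map_smul' := by
        intro c f
        ext v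
        simp only [lp.coeFn_smul, Pi.smul_apply, smul_eq_mul, RingHom.id_apply]
        rw [← tsum_mul_left]
        exact tsum_congr fun w => by ring }
  let A : lp (fun _ : I => ℂ) 2 →L[ℂ] lp (fun _ : I => ℂ) 2 :=
    T.mkContinuous |C| fun f => by
      refine lp.norm_le_of_forall_sum_le (by norm_num) (by positivity) fun s => ?_
      have := hfin f s
      have h2 : (|C| * ‖f‖) ^ 2 = C * (C * ‖f‖ ^ 2) := by rw [mul_pow, sq_abs]; ring
      rw [← h2] at this
      simpa [T] using this
  have hA : ∀ f v, A f v = ∑' w, M v w * f w := fun f v => rfl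
  refine ⟨A, ?_, hA⟩
  have hsingle : ∀ w a v, A (lp.single 2 w a) v = M v w * a := by
    intro w a v
    rw [hA, tsum_eq_single w, lp.single_apply_self]
    intro u hu
    rw [lp.single_apply_ne _ _ _ hu, mul_zero]
  show star A = A
  rw [ContinuousLinearMap.star_eq_adjoint]
  refine lp.ext_continuousLinearMap (by norm_num) fun w => ?_
  ext v
  simp only [ContinuousLinearMap.comp_apply, lp.singleContinuousLinearMap_apply]
  rw [hsingle]
  have h := lp.inner_single_left (𝕜 := ℂ) (G := fun _ : I => ℂ) v 1
    (ContinuousLinearMap.adjoint A (lp.single 2 w 1))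
  rw [ContinuousLinearMap.adjoint_inner_right, lp.inner_single_right, hsingle, hM v w] at h
  simpa [mul_comm] using h.symm

theorem create_annih {S : Type*} [DecidableEq S] (x y : S) (ψ : Wave S) (n : ℕ)
    (hψ : ∀ (σ : Equiv.Perm (Fin n)) (v : Fin n → S), ψ n (v ∘ σ) = ψ n v) (v : Fin n → S) :
    create x (annih y ψ) n v = ∑ i, if v i = x then ψ n (Function.update v i y) else 0 := by
  cases n with
  | zero => simp [create]
  | succ m =>
    have h0 : ((√((m : ℝ) + 1) : ℝ) : ℂ) ≠ 0 := by
      rw [Complex.ofReal_ne_zero]; positivity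
    have h1 : ∀ i : Fin (m + 1), ψ (m + 1) (Fin.cons y (i.removeNth v)) =
        ψ (m + 1) (Function.update v i y) := by
      intro i
      rw [← hψ i.cycleRange, Fin.cons_comp_cycleRange, Fin.insertNth_removeNth]
    simp only [create, annih, h1, Finset.mul_sum]
    refine Finset.sum_congr rfl fun i _ => ?_
    by_cases h : v i = x
    · simp only [h, if_true, Complex.ofReal_inv]
      rw [← mul_assoc, inv_mul_cancel₀ h0, one_mul]
    · simp [h]

theorem num_eq {S : Type*} [DecidableEq S] (x : S) (ψ : Wave S) (n : ℕ)
    (hψ : ∀ (σ : Equiv.Perm (Fin n)) (v : Fin n → S), ψ n (v ∘ σ) = ψ n v) (v : Fin n → S) :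
    num x ψ n v = (∑ i, if v i = x then (1 : ℂ) else 0) * ψ n v := by
  rw [num, create_annih x x ψ n hψ, Finset.sum_mul]
  refine Finset.sum_congr rfl fun i _ => ?_
  by_cases h : v i = x
  · simp [← h]
  · simp [h]

theorem sum_comp_perm {S : Type*} [DecidableEq S] (x : S) {n : ℕ} (σ : Equiv.Perm (Fin n))
    (v : Fin n → S) : (∑ i, if (v ∘ σ) i = x then (1 : ℂ) else 0) =
      ∑ i, if v i = x then (1 : ℂ) else 0 :=
  Equiv.sum_comp σ fun i => if v i = x then (1 : ℂ) else 0

theorem num_num_eq {S : Type*} [DecidableEq S] (x : S) (ψ : Wave S) (n : ℕ)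
    (hψ : ∀ (σ : Equiv.Perm (Fin n)) (v : Fin n → S), ψ n (v ∘ σ) = ψ n v) (v : Fin n → S) :
    num x (num x ψ) n v = (∑ i, if v i = x then (1 : ℂ) else 0) ^ 2 * ψ n v := by
  rw [num_eq x (num x ψ) n, num_eq x ψ n hψ, sq, mul_assoc]
  intro σ w
  rw [num_eq x ψ n hψ, num_eq x ψ n hψ, hψ, sum_comp_perm]

open Classical in
/-- The part of the kernel in which the `i`-th particle hops. -/
def hop {S : Type*} (Λ : Set S) (J : Λ → Λ → ℂ) (n : ℕ) (i : Fin n) (v w : Fin n → S) : ℂ :=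
  if h : v i ∈ Λ ∧ w i ∈ Λ ∧ w = Function.update v i (w i) then
    J ⟨v i, h.1⟩ ⟨w i, h.2.1⟩ else 0

open Classical in
/-- The diagonal part of the kernel. -/
def diag {S : Type*} (Λ : Set S) (g μ : ℝ) (n : ℕ) (v : Fin n → S) : ℝ :=
  g / 2 * (∑ i, ∑ j, if v i ∈ Λ ∧ v i = v j then (1 : ℝ) else 0)
    - (g / 2 + μ) * ∑ i, if v i ∈ Λ then (1 : ℝ) else 0

open Classical in
/-- The integral kernel of `H_n`. -/
def kernel {S : Type*} (Λ : Set S) (J : Λ → Λ → ℂ) (g μ : ℝ) (n : ℕ) (v w : Fin n → S) : ℂ :=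
  (if w = v then (diag Λ g μ n v : ℂ) else 0) - ∑ i, hop Λ J n i v w

theorem hop_star {S : Type*} (Λ : Set S) (J : Λ → Λ → ℂ) (hJ : ∀ x y, J y x = star (J x y))
    (n : ℕ) (i : Fin n) (v w : Fin n → S) : hop Λ J n i w v = star (hop Λ J n i v w) := by
  unfold hop
  have hiff : (w i ∈ Λ ∧ v i ∈ Λ ∧ v = Function.update w i (v i)) ↔
      (v i ∈ Λ ∧ w i ∈ Λ ∧ w = Function.update v i (w i)) := by
    constructor
    · rintro ⟨h1, h2, h3⟩
      exact ⟨h2, h1, by rw [h3]; simp⟩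
    · rintro ⟨h1, h2, h3⟩
      exact ⟨h2, h1, by rw [h3]; simp⟩
  by_cases h : v i ∈ Λ ∧ w i ∈ Λ ∧ w = Function.update v i (w i)
  · rw [dif_pos h, dif_pos (hiff.2 h), hJ]
  · rw [dif_neg h, dif_neg (fun h' => h (hiff.1 h')), star_zero]

theorem kernel_star {S : Type*} (Λ : Set S) (J : Λ → Λ → ℂ) (hJ : ∀ x y, J y x = star (J x y))
    (g μ : ℝ) (n : ℕ) (v w : Fin n → S) :
    kernel Λ J g μ n w v = star (kernel Λ J g μ n v w) := by
  unfold kernel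
  rw [star_sub, star_sum]
  congr 1
  · by_cases h : w = v
    · subst h; simp
    · rw [if_neg h, if_neg (Ne.symm h), star_zero]
  · exact Finset.sum_congr rfl fun i _ => hop_star Λ J hJ n i v w

theorem hop_perm {S : Type*} (Λ : Set S) (J : Λ → Λ → ℂ) (n : ℕ) (i : Fin n)
    (σ : Equiv.Perm (Fin n)) (v w : Fin n → S) :
    hop Λ J n i (v ∘ σ) (w ∘ σ) = hop Λ J n (σ i) v w := by
  have hiff : w ∘ σ = Function.update (v ∘ σ) i (w (σ i)) ↔
      w = Function.update v (σ i) (w (σ i)) := by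
    have h1 : Function.update (v ∘ σ) i (w (σ i)) =
        Function.update v (σ i) (w (σ i)) ∘ σ := by
      rw [Function.update_comp_eq_of_injective v σ.injective]
    rw [h1]
    exact σ.surjective.injective_comp_right.eq_iff
  unfold hop
  by_cases h : v (σ i) ∈ Λ ∧ w (σ i) ∈ Λ ∧ w = Function.update v (σ i) (w (σ i))
  · rw [dif_pos h, dif_pos ⟨h.1, h.2.1, hiff.2 h.2.2⟩]
    rfl
  · rw [dif_neg h, dif_neg fun h' => h ⟨h'.1, h'.2.1, hiff.1 h'.2.2⟩]

theorem kernel_perm {S : Type*} (Λ : Set S) (J : Λ → Λ → ℂ) (g μ : ℝ) (n : ℕ)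
    (σ : Equiv.Perm (Fin n)) (v w : Fin n → S) :
    kernel Λ J g μ n (v ∘ σ) (w ∘ σ) = kernel Λ J g μ n v w := by
  classical
  unfold kernel
  have h1 : diag Λ g μ n (v ∘ σ) = diag Λ g μ n v := by
    unfold diag
    simp only [Function.comp_apply]
    rw [Equiv.sum_comp σ (fun i => ∑ j, if v i ∈ Λ ∧ v i = v (σ j) then (1 : ℝ) else 0),
      Equiv.sum_comp σ (fun i => if v i ∈ Λ then (1 : ℝ) else 0)]
    congr 2
    exact Finset.sum_congr rfl fun i _ =>
      Equiv.sum_comp σ (fun j => if v i ∈ Λ ∧ v i = v j then (1 : ℝ) else 0)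
  simp only [h1, hop_perm, σ.surjective.injective_comp_right.eq_iff]
  rw [Equiv.sum_comp σ fun i => hop Λ J n i v w]

theorem hasSum_hop {S : Type*} {E : Type*} [AddCommMonoid E] [TopologicalSpace E] [DecidableEq S]
    (Λ : Set S) (J : Λ → Λ → ℂ) (n : ℕ) (i : Fin n) (v : Fin n → S)
    (F : ℂ → (Fin n → S) → E) (hF : ∀ w, F 0 w = 0) (h : v i ∈ Λ) {a : E}
    (ha : HasSum (fun y : Λ => F (J ⟨v i, h⟩ y) (Function.update v i y)) a) :
    HasSum (fun w => F (hop Λ J n i v w) w) a := by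
  have hinj : Function.Injective fun y : Λ => Function.update v i (y : S) := fun y z hyz =>
    Subtype.ext (Function.update_injective v i hyz)
  refine (hinj.hasSum_iff ?_).1 ?_
  · intro w hw
    rw [hop, dif_neg, hF]
    rintro ⟨_, h2, h3⟩
    exact hw ⟨⟨w i, h2⟩, h3.symm⟩
  · convert ha using 2 with y
    have : hop Λ J n i v (Function.update v i (y : S)) = J ⟨v i, h⟩ y := by
      rw [hop, dif_pos ⟨h, by simp, by simp⟩]
      congr 1
      simp
    simp only [Function.comp_apply, this]

theorem summable_norm_hop {S : Type*} (Λ : Set S) (J : Λ → Λ → ℂ) (B : ℝ)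
    (hs : ∀ x, Summable fun y => ‖J x y‖) (hB : ∀ x, ∑' y, ‖J x y‖ ≤ B)
    (n : ℕ) (i : Fin n) (v : Fin n → S) :
    (Summable fun w => ‖hop Λ J n i v w‖) ∧ ∑' w, ‖hop Λ J n i v w‖ ≤ |B| := by
  classical
  by_cases h : v i ∈ Λ
  · have := hasSum_hop Λ J n i v (fun z _ => ‖z‖) (fun _ => norm_zero) h (hs ⟨v i, h⟩).hasSum
    exact ⟨this.summable, by rw [this.tsum_eq]; exact (hB _).trans (le_abs_self B)⟩
  · have : ∀ w, hop Λ J n i v w = 0 := fun w => dif_neg fun h' => h h'.1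
    simp only [this, norm_zero]
    exact ⟨summable_zero, by simp⟩

theorem abs_diag_le {S : Type*} (Λ : Set S) (g μ : ℝ) (n : ℕ) (v : Fin n → S) :
    |diag Λ g μ n v| ≤ |g / 2| * (n * n) + |g / 2 + μ| * n := by
  classical
  have h1 : |∑ i, ∑ j, if v i ∈ Λ ∧ v i = v j then (1 : ℝ) else 0| ≤ n * n := by
    rw [abs_of_nonneg (by positivity)]
    refine (Finset.sum_le_sum fun i _ => Finset.sum_le_sum fun j _ =>
      (ite_le_one le_rfl zero_le_one)).trans ?_
    simp
  have h2 : |∑ i, if v i ∈ Λ then (1 : ℝ) else 0| ≤ n := by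
    rw [abs_of_nonneg (by positivity)]
    refine (Finset.sum_le_sum fun i _ => (ite_le_one le_rfl zero_le_one)).trans ?_
    simp
  unfold diag
  refine (abs_sub _ _).trans ?_
  rw [abs_mul, abs_mul]
  gcongr

theorem summable_norm_kernel {S : Type*} (Λ : Set S) (J : Λ → Λ → ℂ) (B : ℝ)
    (hs : ∀ x, Summable fun y => ‖J x y‖) (hB : ∀ x, ∑' y, ‖J x y‖ ≤ B)
    (g μ : ℝ) (n : ℕ) (v : Fin n → S) :
    (Summable fun w => ‖kernel Λ J g μ n v w‖) ∧
      ∑' w, ‖kernel Λ J g μ n v w‖ ≤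
        |g / 2| * (n * n) + |g / 2 + μ| * n + n * |B| := by
  classical
  have h1 : HasSum (fun w => ‖if w = v then (diag Λ g μ n v : ℂ) else 0‖) |diag Λ g μ n v| := by
    convert hasSum_ite_eq v |diag Λ g μ n v| using 2 with w
    by_cases h : w = v <;> simp [h]
  have h2 := fun i => summable_norm_hop Λ J B hs hB n i v
  have h3 : Summable fun w => ∑ i, ‖hop Λ J n i v w‖ := summable_sum fun i _ => (h2 i).1
  have hle : ∀ w, ‖kernel Λ J g μ n v w‖ ≤
      ‖if w = v then (diag Λ g μ n v : ℂ) else 0‖ + ∑ i, ‖hop Λ J n i v w‖ := fun w =>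
    (norm_sub_le _ _).trans (add_le_add_right (norm_sum_le _ _) _)
  have hsum : Summable fun w => ‖kernel Λ J g μ n v w‖ :=
    Summable.of_nonneg_of_le (fun _ => norm_nonneg _) hle (h1.summable.add h3)
  refine ⟨hsum, (hsum.tsum_le_tsum hle (h1.summable.add h3)).trans ?_⟩
  rw [h1.summable.tsum_add h3, h1.tsum_eq, Summable.tsum_finsetSum fun i _ => (h2 i).1]
  refine add_le_add (abs_diag_le Λ g μ n v) ?_
  refine (Finset.sum_le_sum fun i _ => (h2 i).2).trans ?_
  simp

theorem hamExpr_eq {S : Type*} (Λ : Set S) (J : Λ → Λ → ℂ)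
    (hs : ∀ x, Summable fun y => ‖J x y‖) (g μ : ℝ) (n : ℕ) (ψ : Wave S)
    (hψ : ∀ (σ : Equiv.Perm (Fin n)) (v : Fin n → S), ψ n (v ∘ σ) = ψ n v)
    (K : ℝ) (hK : ∀ v, ‖ψ n v‖ ≤ K) (v : Fin n → S) :
    hamExpr Λ J g μ ψ n v = ∑' w, kernel Λ J g μ n v w * ψ n w := by
  classical
  have hsJ : ∀ x i, Summable fun y : Λ => J x y * ψ n (Function.update v i y) := by
    intro x i
    refine Summable.of_norm_bounded ((hs x).mul_right K) fun y => ?_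
    rw [norm_mul]
    exact mul_le_mul_of_nonneg_left (hK _) (norm_nonneg _)
  -- the hopping part
  let a : Fin n → ℂ := fun i =>
    if h : v i ∈ Λ then ∑' y : Λ, J ⟨v i, h⟩ y * ψ n (Function.update v i y) else 0
  have ha : ∀ i, HasSum (fun w => hop Λ J n i v w * ψ n w) (a i) := by
    intro i
    by_cases h : v i ∈ Λ
    · simp only [a, dif_pos h]
      exact hasSum_hop Λ J n i v (fun z w => z * ψ n w) (fun w => zero_mul _) h
        (hsJ ⟨v i, h⟩ i).hasSum
    · have : ∀ w, hop Λ J n i v w = 0 := fun w => dif_neg fun h' => h h'.1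
      simp only [a, dif_neg h, this, zero_mul]
      exact hasSum_zero
  have hRHS : HasSum (fun w => kernel Λ J g μ n v w * ψ n w)
      ((diag Λ g μ n v : ℂ) * ψ n v - ∑ i, a i) := by
    have h1 : HasSum (fun w => (if w = v then (diag Λ g μ n v : ℂ) else 0) * ψ n w)
        ((diag Λ g μ n v : ℂ) * ψ n v) := by
      convert hasSum_ite_eq v ((diag Λ g μ n v : ℂ) * ψ n v) using 2 with w
      by_cases h : w = v
      · simp [h]
      · simp [h]
    have := h1.sub (hasSum_sum fun i (_ : i ∈ Finset.univ) => ha i)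
    have h2 : (fun w => kernel Λ J g μ n v w * ψ n w) = fun w =>
        (if w = v then (diag Λ g μ n v : ℂ) else 0) * ψ n w -
          ∑ i, hop Λ J n i v w * ψ n w := by
      funext w
      rw [kernel, sub_mul, Finset.sum_mul]
    rw [h2]
    exact this
  rw [hRHS.tsum_eq]
  -- sums over occupied sites
  have hocc : ∀ (c : Fin n → Λ → ℂ),
      HasSum (fun x : Λ => ∑ i, if v i = (x : S) then c i x else 0)
        (∑ i, if h : v i ∈ Λ then c i ⟨v i, h⟩ else 0) := by
    intro c
    refine hasSum_sum fun i _ => ?_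
    by_cases h : v i ∈ Λ
    · rw [dif_pos h]
      convert hasSum_ite_eq (⟨v i, h⟩ : Λ) (c i ⟨v i, h⟩) using 2 with x
      by_cases hx : v i = x
      · have : x = ⟨v i, h⟩ := Subtype.ext hx.symm
        subst this
        simp
      · rw [if_neg hx, if_neg]
        intro hx'
        exact hx (by rw [hx'])
    · rw [dif_neg h]
      convert hasSum_zero (α := ℂ) (β := Λ) using 2 with x
      rw [if_neg]
      intro hx
      exact h (by rw [hx]; exact x.2)
  have hT : (∑' x : Λ, ∑' y : Λ, J x y * create (x : S) (annih (y : S) ψ) n v) = ∑ i, a i := by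
    refine Eq.trans (tsum_congr fun x => ?_)
      (hocc fun i x => ∑' y : Λ, J x y * ψ n (Function.update v i y)).tsum_eq
    have h1 : ∀ y : Λ, J x y * create (x : S) (annih (y : S) ψ) n v =
        ∑ i, if v i = x then J x y * ψ n (Function.update v i y) else 0 := by
      intro y
      rw [create_annih _ _ ψ n hψ, Finset.mul_sum]
      exact Finset.sum_congr rfl fun i _ => by split_ifs <;> simp
    simp only [h1]
    rw [Summable.tsum_finsetSum]
    · refine Finset.sum_congr rfl fun i _ => ?_
      split_ifs
      · rfl
      · simp
    · intro i _
      split_ifs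
      · exact hsJ x i
      · exact summable_zero
  have hN : HasSum (fun x : Λ => ∑ i, if v i = (x : S) then (1 : ℂ) else 0)
      (∑ i, if v i ∈ Λ then (1 : ℂ) else 0) := by
    convert hocc fun _ _ => 1 using 2
    split_ifs <;> rfl
  have hN2 : HasSum (fun x : Λ => (∑ i, if v i = (x : S) then (1 : ℂ) else 0) ^ 2)
      (∑ i, ∑ j, if v i ∈ Λ ∧ v i = v j then (1 : ℂ) else 0) := by
    convert hocc fun i x => ∑ j, if v j = (x : S) then (1 : ℂ) else 0 using 2 with x i
    · rw [sq, Finset.sum_mul]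
      exact Finset.sum_congr rfl fun i _ => by split_ifs <;> simp
    · by_cases h : v i ∈ Λ
      · simp [h, eq_comm]
      · simp [h]
  rw [hamExpr, hT]
  simp only [num_num_eq _ ψ n hψ, num_eq _ ψ n hψ]
  rw [((hN2.mul_right (ψ n v)).sub (hN.mul_right (ψ n v))).tsum_eq,
    (hN.mul_right (ψ n v)).tsum_eq, diag]
  push_cast
  simp only [apply_ite Complex.ofReal, Complex.ofReal_one, Complex.ofReal_zero]
  ring

/-- If `J` is Hermitian with bounded row sums, then `H_n` is given by the expression for `H`. -/
theorem sectorHam_apply {S : Type*} (Λ : Set S) (J : Λ → Λ → ℂ)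
    (hJ : ∀ x y, J y x = star (J x y)) (B : ℝ)
    (hs : ∀ x, Summable fun y => ‖J x y‖) (hB : ∀ x, ∑' y, ‖J x y‖ ≤ B)
    (g μ : ℝ) (n : ℕ) (φ : Sector S n) (v : Fin n → S) :
    (sectorHam Λ J g μ n φ).toFun v = hamExpr Λ J g μ (sectorWave φ) n v := by
  obtain ⟨A, hA, hAf⟩ := exists_schur (kernel Λ J g μ n) (kernel_star Λ J hJ g μ n) _
    (fun v => (summable_norm_kernel Λ J B hs hB g μ n v).1)
    (fun v => (summable_norm_kernel Λ J B hs hB g μ n v).2)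
  have hmaps : ∀ f ∈ symmFun S n, A f ∈ symmFun S n := by
    intro f hf σ v
    rw [hAf, hAf, ← (σ.symm.arrowCongr (Equiv.refl S)).tsum_eq]
    refine tsum_congr fun w => ?_
    have hw : (σ.symm.arrowCongr (Equiv.refl S)) w = w ∘ σ := by
      ext i; simp [Equiv.arrowCongr]
    rw [hw, kernel_perm, hf σ w]
  let A' : symmFun S n →L[ℂ] symmFun S n := A.restrict hmaps
  have hsym : A.IsSymmetric := ContinuousLinearMap.isSelfAdjoint_iff_isSymmetric.1 hA
  have hex : ∃ A : Sector S n →L[ℂ] Sector S n, IsSelfAdjoint A ∧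
      ∀ (φ : Sector S n) (v : Fin n → S),
        (A φ).toFun v = hamExpr Λ J g μ (sectorWave φ) n v := by
    refine ⟨(show Sector S n →L[ℂ] Sector S n from A'), ?_, ?_⟩
    · rw [ContinuousLinearMap.isSelfAdjoint_iff_isSymmetric]
      intro f h
      exact hsym (show symmFun S n from f).1 (show symmFun S n from h).1
    · intro φ v
      have h1 : sectorWave φ n = φ.toFun := 
        Pi.single_eq_same (M := fun n => (Fin n → S) → ℂ) n φ.toFun
      rw [hamExpr_eq Λ J hs g μ n (sectorWave φ) ?_ ‖φ‖ ?_ v, h1]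
      · exact hAf (show symmFun S n from φ).1 v
      · intro σ w
        rw [h1]
        exact (show symmFun S n from φ).2 σ w
      · intro w
        rw [h1]
        exact lp.norm_apply_le_norm (by norm_num) (show symmFun S n from φ).1 w
  unfold sectorHam
  rw [dif_pos hex]
  exact hex.choose_spec.2 φ v

end

end BoseHubbard

/-! The proof finds a time-dependent one-body weight whose expectation cannot grow and which
compares with the indicator functions of the two regions at times 0 and `t`.

Fix a smoothed step `χ` and a 1-Lipschitz function `h` on the sites, and set `f_t(x) = χ((h x - c'
t) / s)` with a speed `c'` strictly between `κ` and `c`. In each particle-number sector the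
expectation of `dΓ(f_t)` has derivative `⟨dΓ(∂_t f_t)⟩ + ⟨i[H, dΓ(f_t)]⟩`. Interaction and chemical
potential are diagonal in the configuration and commute with `dΓ(f_t)`, so only hopping contributes
and every bound is uniform in `g` and `μ`. Antisymmetry of the current and the inequality `2ab ≤ a²
+ b²` bound the commutator term by `⟨dΓ(V_t)⟩`, where `V_t(x) = ∑_y |f_t(x) - f_t(y)| |J_xy|`
(`two_mul_tsum_im_le`, `tsum_weight_mul_norm_kernel_le`). The expectation is therefore nonincreasing
once `V_t ≤ -∂_t f_t` (`antitone_tsum_weight`).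

This pointwise inequality dictates the choice of `χ`. Its derivative decays only like
`|r|^{-(q+1)}`, `q = p - 1`, which gives `|χ(r) - χ(u)| ≤ χ'(r) ((1+ε)|r-u| + K|r-u|^{q+1})`
(`exists_abs_profile_sub_le`). After rescaling by `s`, the first term costs `(1+ε)κ`, the second a
multiple of `κ_J^{(p)} / s^q`; for small `ε` and large fixed `s` the total is at most `c'`. No
remainder is left, so no iteration over the order of decay is needed.

The tails of `χ` at distance of order `ρ` from the front give the error `ρ^{-q}` times the particle
number, once at time `t` and once at time 0 (`exists_particles_evol_le_add`). The linear room `ρ - b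
- c' t ≥ const · ρ` comes from `c' < c` and `b ≤ max B (θρ)` when `ρ` is large; for bounded `ρ`
conservation of the particle number suffices. The outgoing and incoming bounds use `h = ‖x‖ + const`
and `h = const - ‖x‖`. -/

namespace BoseHubbard

noncomputable section

/-! ### An increasing profile with polynomial tails -/

/-- An increasing function from `0` at `-∞` to `1` at `∞` whose derivative decays like
`|r| ^ (-(q + 1))`. -/
def profile (q : ℕ) (r : ℝ) : ℝ :=
  if r ≤ 0 then 2⁻¹ * ((1 - r) ^ q)⁻¹ else 1 - 2⁻¹ * ((1 + r) ^ q)⁻¹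

/-- The derivative of `profile`. -/
def profileDeriv (q : ℕ) (r : ℝ) : ℝ := q / 2 * ((1 + |r|) ^ (q + 1))⁻¹

theorem profile_of_nonpos (q : ℕ) {r : ℝ} (hr : r ≤ 0) :
    profile q r = 2⁻¹ * ((1 - r) ^ q)⁻¹ := if_pos hr

theorem profile_of_nonneg (q : ℕ) {r : ℝ} (hr : 0 ≤ r) :
    profile q r = 1 - 2⁻¹ * ((1 + r) ^ q)⁻¹ := by
  rcases hr.eq_or_lt with rfl | h
  · norm_num [profile]
  · exact if_neg h.not_ge

/-- This symmetry gives both tails of the step the same size and transfers bounds from one side of 0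
to the other. -/
theorem profile_neg (q : ℕ) (r : ℝ) : profile q (-r) = 1 - profile q r := by
  rcases le_total r 0 with h | h
  · rw [profile_of_nonpos q h, profile_of_nonneg q (neg_nonneg.2 h), sub_eq_add_neg 1 r]
  · rw [profile_of_nonneg q h, profile_of_nonpos q (neg_nonpos.2 h)]
    ring_nf

theorem profile_nonneg (q : ℕ) (r : ℝ) : 0 ≤ profile q r := by
  rcases le_total r 0 with h | h
  · rw [profile_of_nonpos q h]
    have : 0 ≤ 1 - r := by linarith
    positivity
  · rw [profile_of_nonneg q h]
    have : ((1 + r) ^ q)⁻¹ ≤ 1 := inv_le_one_of_one_le₀ (one_le_pow₀ (by linarith))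
    linarith

theorem profile_le_one (q : ℕ) (r : ℝ) : profile q r ≤ 1 := by
  have := profile_nonneg q (-r)
  rw [profile_neg] at this
  linarith

theorem profileDeriv_nonneg (q : ℕ) (r : ℝ) : 0 ≤ profileDeriv q r := by
  unfold profileDeriv
  positivity

theorem profileDeriv_neg (q : ℕ) (r : ℝ) : profileDeriv q (-r) = profileDeriv q r := by
  simp [profileDeriv]

theorem hasDerivAt_inv_pow_one_add (q : ℕ) {r : ℝ} (hr : 0 ≤ r) :
    HasDerivAt (fun u : ℝ => 1 - 2⁻¹ * ((1 + u) ^ q)⁻¹) (profileDeriv q r) r := by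
  have h1 : (1 + r) ≠ 0 := by positivity
  have h := ((((hasDerivAt_id r).const_add 1).pow q).inv (pow_ne_zero q h1)).const_mul (2⁻¹ : ℝ)
  refine (h.const_sub 1).congr_deriv ?_
  rw [profileDeriv, abs_of_nonneg hr]
  simp only [id, mul_one, Pi.pow_apply]
  -- The power rule produces the exponent `q - 1`, truncated at `q = 0`, where both sides vanish.
  rcases q with _ | q
  · simp
  · simp only [Nat.add_sub_cancel]
    field_simp
    ring

/-- The two branches agree at 0 in value `1/2` and in slope `q/2`, so the one-sided derivatives
glue. -/
theorem hasDerivAt_profile (q : ℕ) (r : ℝ) : HasDerivAt (profile q) (profileDeriv q r) r := by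
  have hright : ∀ {r : ℝ}, 0 ≤ r →
      HasDerivWithinAt (profile q) (profileDeriv q r) (Set.Ici 0) r := fun {r} hr =>
    (hasDerivAt_inv_pow_one_add q hr).hasDerivWithinAt.congr
      (fun u hu => profile_of_nonneg q hu) (profile_of_nonneg q hr)
  have hleft : ∀ {r : ℝ}, r ≤ 0 →
      HasDerivWithinAt (profile q) (profileDeriv q r) (Set.Iic 0) r := by
    intro r hr
    have h := (hasDerivAt_inv_pow_one_add q (neg_nonneg.2 hr)).scomp r (hasDerivAt_neg r)
    have h2 : HasDerivAt (fun u : ℝ => 2⁻¹ * ((1 - u) ^ q)⁻¹) (profileDeriv q r) r := by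
      refine ((h.const_sub 1).congr_deriv (by simp [profileDeriv_neg])).congr_of_eventuallyEq
        (Filter.Eventually.of_forall fun u => ?_)
      simp [sub_eq_add_neg]
    exact h2.hasDerivWithinAt.congr (fun u hu => profile_of_nonpos q hu) (profile_of_nonpos q hr)
  rcases lt_trichotomy r 0 with h | rfl | h
  · exact (hleft h.le).hasDerivAt (Iic_mem_nhds h)
  · have := (hleft le_rfl).union (hright le_rfl)
    rwa [Set.Iic_union_Ici, hasDerivWithinAt_univ] at this
  · exact (hright h.le).hasDerivAt (Ici_mem_nhds h)

theorem monotone_profile (q : ℕ) : Monotone (profile q) :=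
  monotone_of_hasDerivAt_nonneg (hasDerivAt_profile q) (profileDeriv_nonneg q)

theorem profileDeriv_le (q : ℕ) (r : ℝ) : profileDeriv q r ≤ q / 2 := by
  have : ((1 + |r|) ^ (q + 1))⁻¹ ≤ 1 :=
    inv_le_one_of_one_le₀ (one_le_pow₀ (by linarith [abs_nonneg r]))
  exact mul_le_of_le_one_right (by positivity) this

/-- The function `(1 + |r|)⁻¹` is 1-Lipschitz with values in `[0, 1]`, so its power `q + 1` is `(q +
1)`-Lipschitz. -/
theorem abs_profileDeriv_sub_le (q : ℕ) (r u : ℝ) :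
    |profileDeriv q u - profileDeriv q r| ≤ q / 2 * (q + 1) * |u - r| := by
  have hr : 1 ≤ 1 + |r| := by linarith [abs_nonneg r]
  have hu : 1 ≤ 1 + |u| := by linarith [abs_nonneg u]
  have hr0 : 0 < 1 + |r| := by linarith
  have hu0 : 0 < 1 + |u| := by linarith
  have h1 : |(1 + |u|)⁻¹ - (1 + |r|)⁻¹| ≤ |u - r| := by
    rw [inv_sub_inv hu0.ne' hr0.ne', abs_div, abs_of_pos (mul_pos hu0 hr0)]
    refine (div_le_self (abs_nonneg _) (one_le_mul_of_one_le_of_one_le hu hr)).trans ?_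
    rw [add_sub_add_left_eq_sub, abs_sub_comm]
    exact abs_abs_sub_abs_le u r
  have h2 := abs_pow_sub_pow_le (1 + |u|)⁻¹ (1 + |r|)⁻¹ (q + 1)
  have h3 : max |(1 + |u|)⁻¹| |(1 + |r|)⁻¹| ^ (q + 1 - 1) ≤ 1 := by
    refine pow_le_one₀ (by positivity) (max_le ?_ ?_)
    · rw [abs_of_pos (inv_pos.2 hu0)]; exact inv_le_one_of_one_le₀ hu
    · rw [abs_of_pos (inv_pos.2 hr0)]; exact inv_le_one_of_one_le₀ hr
  unfold profileDeriv
  rw [← mul_sub, abs_mul, abs_of_nonneg (by positivity : (0 : ℝ) ≤ q / 2), mul_assoc,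
    ← inv_pow, ← inv_pow]
  refine mul_le_mul_of_nonneg_left (h2.trans ?_) (by positivity)
  calc _ ≤ |u - r| * ((q + 1 : ℕ) : ℝ) * 1 := by gcongr
    _ = _ := by push_cast; ring

/-- A Lipschitz derivative replaces a second derivative, which the kink of `profileDeriv` at 0 rules
out for `q ≥ 1`. The uniform quadratic remainder makes the weights differentiable in operator norm.
-/
theorem abs_profile_sub_sub_le (q : ℕ) (r u : ℝ) :
    |profile q u - profile q r - profileDeriv q r * (u - r)| ≤
      q / 2 * (q + 1) * (u - r) ^ 2 := by
  have h := (convex_uIcc r u).norm_image_sub_le_of_norm_hasDerivWithin_le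
    (f := fun x => profile q x - profileDeriv q r * x)
    (f' := fun x => profileDeriv q x - profileDeriv q r * 1)
    (C := q / 2 * (q + 1) * |u - r|) (fun x _ =>
      ((hasDerivAt_profile q x).sub ((hasDerivAt_id x).const_mul _)).hasDerivWithinAt)
    (fun x hx => by
      rw [mul_one, Real.norm_eq_abs]
      refine (abs_profileDeriv_sub_le q r x).trans ?_
      exact mul_le_mul_of_nonneg_left (Set.abs_sub_left_of_mem_uIcc hx) (by positivity))
    Set.left_mem_uIcc Set.right_mem_uIcc
  rw [Real.norm_eq_abs, Real.norm_eq_abs, mul_assoc, ← sq, sq_abs] at h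
  convert h using 2
  ring

/-- For `|r - u| ≤ η (1 + |r|)` the derivative between `r` and `u` is at most `(1 + ε)` times its
value at `r`, and the mean value inequality applies. For larger jumps, `|r - u|^{q+1}` compensates
the decay of `profileDeriv q r`, and the trivial bound 1 on the left is enough. -/
theorem exists_abs_profile_sub_le {q : ℕ} (hq : 1 ≤ q) {ε : ℝ} (hε : 0 < ε) :
    ∃ K : ℝ, 0 ≤ K ∧ ∀ r u : ℝ, |profile q r - profile q u| ≤
      profileDeriv q r * ((1 + ε) * |r - u| + K * |r - u| ^ (q + 1)) := by
  obtain ⟨η, hη0, hη1, hη⟩ : ∃ η : ℝ, 0 < η ∧ η < 1 ∧ ((1 - η) ^ (q + 1))⁻¹ ≤ 1 + ε := by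
    have hc : Filter.Tendsto (fun η : ℝ => ((1 - η) ^ (q + 1))⁻¹) (nhdsWithin 0 (Set.Ioi 0))
        (nhds 1) := by
      have : ContinuousAt (fun η : ℝ => ((1 - η) ^ (q + 1))⁻¹) 0 :=
        ContinuousAt.inv₀ (by fun_prop) (by simp)
      simpa using this.tendsto.mono_left nhdsWithin_le_nhds
    have h1 := hc.eventually (eventually_le_nhds (show (1 : ℝ) < 1 + ε by linarith))
    have h2 : ∀ᶠ η : ℝ in nhdsWithin 0 (Set.Ioi 0), η < 1 :=
      nhdsWithin_le_nhds (eventually_lt_nhds one_pos)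
    obtain ⟨η, ⟨h3, h4⟩, h5⟩ := ((h1.and h2).and self_mem_nhdsWithin).exists
    exact ⟨η, h5, h4, h3⟩
  have hq0 : (0 : ℝ) < q := by exact_mod_cast hq
  -- This `K` makes `profileDeriv q r * K * (η (1 + |r|))^{q+1}` equal to 1.
  refine ⟨2 / q * (η ^ (q + 1))⁻¹, by positivity, fun r u => ?_⟩
  have hr0 : 0 < 1 + |r| := by positivity
  have hd := profileDeriv_nonneg q r
  rcases le_or_gt |r - u| (η * (1 + |r|)) with h | h
  · have key : |profile q r - profile q u| ≤ profileDeriv q r * (1 + ε) * |r - u| := by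
      rw [abs_sub_comm, abs_sub_comm r u]
      refine (convex_uIcc r u).norm_image_sub_le_of_norm_hasDerivWithin_le
        (f' := profileDeriv q) (fun x _ => (hasDerivAt_profile q x).hasDerivWithinAt)
        (fun x hx => ?_) Set.left_mem_uIcc Set.right_mem_uIcc
      have hx1 : (1 - η) * (1 + |r|) ≤ 1 + |x| := by
        have h1 := Set.abs_sub_left_of_mem_uIcc hx
        have h2 := abs_sub_abs_le_abs_sub r x
        rw [abs_sub_comm r x] at h2
        rw [abs_sub_comm u r] at h1
        linarith
      rw [Real.norm_eq_abs, abs_of_nonneg (profileDeriv_nonneg q x)]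
      unfold profileDeriv
      rw [mul_assoc]
      refine mul_le_mul_of_nonneg_left ?_ (by positivity)
      have h3 : 0 < (1 - η) := by linarith
      calc ((1 + |x|) ^ (q + 1))⁻¹ ≤ (((1 - η) * (1 + |r|)) ^ (q + 1))⁻¹ := by gcongr
        _ = ((1 + |r|) ^ (q + 1))⁻¹ * ((1 - η) ^ (q + 1))⁻¹ := by
          rw [mul_pow, mul_inv, mul_comm]
        _ ≤ _ := by gcongr
    refine key.trans ?_
    rw [mul_assoc]
    refine mul_le_mul_of_nonneg_left ?_ hd
    have : 0 ≤ 2 / (q : ℝ) * (η ^ (q + 1))⁻¹ * |r - u| ^ (q + 1) := by positivity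
    linarith
  · have h1 : |profile q r - profile q u| ≤ 1 := by
      rw [abs_le]
      constructor <;>
        linarith [profile_nonneg q r, profile_nonneg q u, profile_le_one q r, profile_le_one q u]
    have h2 : 1 ≤ profileDeriv q r * (2 / q * (η ^ (q + 1))⁻¹ * |r - u| ^ (q + 1)) := by
      have h3 : (η * (1 + |r|)) ^ (q + 1) ≤ |r - u| ^ (q + 1) := by gcongr
      calc (1 : ℝ) = profileDeriv q r *
            (2 / q * (η ^ (q + 1))⁻¹ * (η * (1 + |r|)) ^ (q + 1)) := by
            unfold profileDeriv
            rw [mul_pow]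
            field_simp
        _ ≤ _ := by gcongr
    refine h1.trans (h2.trans (mul_le_mul_of_nonneg_left ?_ hd))
    have : 0 ≤ (1 + ε) * |r - u| := by positivity
    linarith

/-! ### Multiplication operators and the flux of a weight under a Hermitian kernel -/

section Multiplication

variable {I : Type*}

theorem hasSum_norm_sq (f : lp (fun _ : I => ℂ) 2) : HasSum (fun v => ‖f v‖ ^ 2) (‖f‖ ^ 2) := by
  simpa using lp.hasSum_norm (p := 2) (by norm_num) f

theorem summable_mul_norm_sq {F : I → ℝ} {K : ℝ} (hF : ∀ v, |F v| ≤ K)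
    (f : lp (fun _ : I => ℂ) 2) : Summable fun v => F v * ‖f v‖ ^ 2 := by
  refine Summable.of_norm_bounded ((hasSum_norm_sq f).summable.mul_left K) fun v => ?_
  rw [norm_mul, Real.norm_eq_abs, Real.norm_of_nonneg (sq_nonneg ‖f v‖)]
  exact mul_le_mul_of_nonneg_right (hF v) (sq_nonneg _)

theorem tsum_mul_norm_sq_le {F : I → ℝ} {K : ℝ} (hF : ∀ v, |F v| ≤ K)
    (f : lp (fun _ : I => ℂ) 2) : ∑' v, ‖(F v : ℂ) * f v‖ ^ 2 ≤ (K * ‖f‖) ^ 2 ∧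
      Summable fun v => ‖(F v : ℂ) * f v‖ ^ 2 := by
  have hle : ∀ v, ‖(F v : ℂ) * f v‖ ^ 2 ≤ K ^ 2 * ‖f v‖ ^ 2 := fun v => by
    rw [norm_mul, mul_pow, Complex.norm_real, Real.norm_eq_abs]
    exact mul_le_mul_of_nonneg_right (pow_le_pow_left₀ (abs_nonneg _) (hF v) 2) (sq_nonneg _)
  have hs := (hasSum_norm_sq f).mul_left (K ^ 2)
  have hs' : Summable fun v => ‖(F v : ℂ) * f v‖ ^ 2 :=
    hs.summable.of_nonneg_of_le (fun _ => sq_nonneg _) hle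
  exact ⟨(hs'.tsum_le_tsum hle hs.summable).trans_eq (by rw [hs.tsum_eq, mul_pow]), hs'⟩

/-- Multiplication by a bounded real function on `ℓ²`. -/
def mulOp (F : I → ℝ) (K : ℝ) (hF : ∀ v, |F v| ≤ K) :
    lp (fun _ : I => ℂ) 2 →L[ℂ] lp (fun _ : I => ℂ) 2 :=
  LinearMap.mkContinuous
    { toFun := fun f => ⟨fun v => (F v : ℂ) * f v,
        memℓp_gen (by simpa using (tsum_mul_norm_sq_le hF f).2)⟩
      map_add' := fun f g => by
        ext v
        exact mul_add _ _ _
      map_smul' := fun a f => by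
        ext v
        exact mul_left_comm _ _ _ }
    |K| fun f => by
      refine abs_le_of_sq_le_sq' ?_ (by positivity) |>.2
      rw [← (hasSum_norm_sq _).tsum_eq]
      refine (tsum_mul_norm_sq_le hF f).1.trans_eq ?_
      rw [mul_pow, mul_pow, sq_abs]

@[simp]
theorem mulOp_apply (F : I → ℝ) (K : ℝ) (hF : ∀ v, |F v| ≤ K) (f : lp (fun _ : I => ℂ) 2)
    (v : I) : mulOp F K hF f v = (F v : ℂ) * f v := rfl

theorem norm_mulOp_le (F : I → ℝ) (K : ℝ) (hF : ∀ v, |F v| ≤ K) : ‖mulOp F K hF‖ ≤ |K| :=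
  LinearMap.mkContinuous_norm_le _ (abs_nonneg K) _

/-- The Taylor remainder is itself a multiplication operator, with norm bounded by its supremum,
hence `O((u - t)²)`. -/
theorem hasDerivAt_mulOp {F F' : ℝ → I → ℝ} {K K' C : ℝ} (hF : ∀ t v, |F t v| ≤ K)
    (hF' : ∀ t v, |F' t v| ≤ K')
    (hd : ∀ t u v, |F u v - F t v - F' t v * (u - t)| ≤ C * (u - t) ^ 2) (t : ℝ) :
    HasDerivAt (fun u => mulOp (F u) K (hF u)) (mulOp (F' t) K' (hF' t)) t := by
  rw [hasDerivAt_iff_isLittleO]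
  refine Asymptotics.IsBigO.trans_isLittleO (g := fun u => (u - t) ^ 2) ?_ ?_
  · refine Asymptotics.IsBigO.of_bound |C| (Filter.Eventually.of_forall fun u => ?_)
    have h : mulOp (F u) K (hF u) - mulOp (F t) K (hF t) - (u - t) • mulOp (F' t) K' (hF' t) =
        mulOp (fun v => F u v - F t v - F' t v * (u - t)) _ (hd t u) := by
      ext f v
      simp only [sub_apply, smul_apply, lp.coeFn_sub,
        Pi.sub_apply, lp.coeFn_smul, Pi.smul_apply, mulOp_apply, Complex.real_smul]
      push_cast
      ring
    rw [h]
    refine (norm_mulOp_le _ _ _).trans_eq ?_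
    rw [abs_mul, Real.norm_eq_abs]
  · exact (Asymptotics.isLittleO_pow_sub_sub t one_lt_two).congr_left fun u => by
      rw [Real.norm_eq_abs, sq_abs]

theorem re_inner_mulOp (F : I → ℝ) (K : ℝ) (hF : ∀ v, |F v| ≤ K) (f : lp (fun _ : I => ℂ) 2) :
    (inner ℂ f (mulOp F K hF f)).re = ∑' v, F v * ‖f v‖ ^ 2 := by
  rw [lp.inner_eq_tsum, Complex.re_tsum (lp.summable_inner _ _)]
  refine tsum_congr fun v => ?_
  rw [mulOp_apply, RCLike.inner_apply, mul_assoc, Complex.mul_conj, ← Complex.ofReal_mul,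
    Complex.ofReal_re, Complex.normSq_eq_norm_sq]

/-- The change of the expectation of the weight `F` under the evolution with the Hermitian kernel
`M` is controlled by the variation of `F` over the range of `M`. -/
theorem two_mul_tsum_im_le {M : I → I → ℂ} (hM : ∀ v w, M w v = star (M v w)) {C : ℝ}
    (hs : ∀ v, Summable fun w => ‖M v w‖) (hC : ∀ v, ∑' w, ‖M v w‖ ≤ C)
    {F : I → ℝ} {K : ℝ} (hF : ∀ v, |F v| ≤ K) (f : lp (fun _ : I => ℂ) 2) :
    2 * ∑' v, F v * (star (f v) * ∑' w, M v w * f w).im ≤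
      ∑' v, (∑' w, |F v - F w| * ‖M v w‖) * ‖f v‖ ^ 2 := by
  have hnorm : ∀ v w, ‖M w v‖ = ‖M v w‖ := fun v w => by rw [hM v w, norm_star]
  obtain ⟨m, hm⟩ : ∃ m : I × I → ℝ, ∀ z, m z = (star (f z.1) * (M z.1 z.2 * f z.2)).im :=
    ⟨_, fun _ => rfl⟩
  obtain ⟨D, hD⟩ : ∃ D : I × I → ℝ, ∀ z, D z = ‖M z.1 z.2‖ * ‖f z.1‖ ^ 2 := ⟨_, fun _ => rfl⟩
  have hD0 : ∀ z, 0 ≤ D z := fun z => by rw [hD]; positivity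
  have hDs : Summable D := by
    refine (summable_prod_of_nonneg hD0).2 ⟨fun v => by simpa only [hD] using (hs v).mul_right _, ?_⟩
    simp only [hD, tsum_mul_right]
    refine ((hasSum_norm_sq f).summable.mul_left C).of_nonneg_of_le (fun v => by positivity)
      fun v => mul_le_mul_of_nonneg_right (hC v) (sq_nonneg _)
  have hDs' : Summable fun z : I × I => D z.swap := (Equiv.prodComm I I).summable_iff.2 hDs
  -- `m` is the probability current between two configurations; it is antisymmetric because `M` is
  -- Hermitian. Symmetrizing therefore replaces `F z.1` by half of `F z.1 - F z.2`.
  have hanti : ∀ z : I × I, m z.swap = -m z := fun z => by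
    have h : star (star (f z.1) * (M z.1 z.2 * f z.2)) =
        star (f z.2) * (M z.2 z.1 * f z.1) := by
      rw [hM z.1 z.2]
      simp only [star_mul', star_star]
      ring
    simp only [hm, Prod.fst_swap, Prod.snd_swap]
    rw [← h]
    exact Complex.conj_im _
  have hmle : ∀ z : I × I, |m z| ≤ 2⁻¹ * (D z + D z.swap) := fun z => by
    have h1 : |m z| ≤ ‖M z.1 z.2‖ * (‖f z.1‖ * ‖f z.2‖) := by
      rw [hm]
      refine (Complex.abs_im_le_norm _).trans_eq ?_
      rw [norm_mul, norm_mul, norm_star]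
      ring
    simp only [hD, Prod.fst_swap, Prod.snd_swap, hnorm z.1 z.2]
    nlinarith [mul_nonneg (norm_nonneg (M z.1 z.2)) (sq_nonneg (‖f z.1‖ - ‖f z.2‖))]
  have hms : Summable m :=
    Summable.of_norm_bounded ((hDs.add hDs').mul_left 2⁻¹) fun z => hmle z
  have hbdd : ∀ {g : I × I → ℝ} {h : I × I → ℝ} {B : ℝ}, Summable g → (∀ z, |h z| ≤ B) →
      Summable fun z => h z * g z := fun {g h B} hg hh =>
    Summable.of_norm_bounded (hg.norm.mul_left B) fun z => by
      rw [norm_mul]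
      exact mul_le_mul_of_nonneg_right (hh z) (norm_nonneg _)
  have h1 : Summable fun z : I × I => F z.1 * m z := hbdd hms fun z => hF z.1
  have h2 : Summable fun z : I × I => F z.2 * m z := hbdd hms fun z => hF z.2
  have hX : ∑' v, F v * (star (f v) * ∑' w, M v w * f w).im = ∑' z : I × I, F z.1 * m z := by
    rw [h1.tsum_prod]
    refine tsum_congr fun v => ?_
    have hv : Summable fun w => star (f v) * (M v w * f w) := by
      refine Summable.mul_left _ (Summable.of_norm_bounded ((hs v).mul_right ‖f‖) fun w => ?_)
      rw [norm_mul]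
      exact mul_le_mul_of_nonneg_left (lp.norm_apply_le_norm (by norm_num) f w) (norm_nonneg _)
    simp only [hm]
    rw [tsum_mul_left, ← tsum_mul_left, Complex.im_tsum hv]
  have hX' : ∑' z : I × I, F z.1 * m z = -∑' z : I × I, F z.2 * m z := by
    rw [← (Equiv.prodComm I I).tsum_eq, ← tsum_neg]
    refine tsum_congr fun z => ?_
    simp only [Equiv.prodComm_apply, hanti, Prod.fst_swap]
    ring
  obtain ⟨W, hW⟩ : ∃ W : I × I → ℝ, ∀ z, W z = |F z.1 - F z.2| := ⟨_, fun _ => rfl⟩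
  have hWle : ∀ z, |W z| ≤ 2 * K := fun z => by
    rw [hW, abs_abs]
    refine (abs_sub _ _).trans ?_
    linarith [hF z.1, hF z.2]
  have hWD := hbdd hDs hWle
  have hWD' := hbdd hDs' hWle
  -- The variation `W` is symmetric, so both halves of the bound on `|m|` contribute equally.
  have hsymm : ∑' z : I × I, W z * D z.swap = ∑' z, W z * D z := by
    rw [← (Equiv.prodComm I I).tsum_eq]
    refine tsum_congr fun z => ?_
    simp only [Equiv.prodComm_apply, Prod.swap_swap, hW, Prod.fst_swap, Prod.snd_swap,
      abs_sub_comm (F z.2)]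
  have hfinal : 2 * ∑' z : I × I, F z.1 * m z ≤ ∑' z, W z * D z := by
    calc 2 * ∑' z : I × I, F z.1 * m z = ∑' z : I × I, (F z.1 * m z - F z.2 * m z) := by
          rw [h1.tsum_sub h2]
          linarith
      _ ≤ ∑' z, (2⁻¹ * (W z * D z) + 2⁻¹ * (W z * D z.swap)) := by
          refine (h1.sub h2).tsum_le_tsum (fun z => ?_)
            ((hWD.mul_left _).add (hWD'.mul_left _))
          rw [← sub_mul, ← mul_add, ← mul_add, mul_left_comm]
          refine (le_abs_self _).trans ?_
          rw [abs_mul, hW]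
          exact mul_le_mul_of_nonneg_left (hmle z) (abs_nonneg _)
      _ = ∑' z, W z * D z := by
          rw [(hWD.mul_left _).tsum_add (hWD'.mul_left _), tsum_mul_left, tsum_mul_left, hsymm]
          ring
  rw [hX]
  refine hfinal.trans_eq ?_
  rw [hWD.tsum_prod]
  refine tsum_congr fun v => ?_
  rw [← tsum_mul_right]
  refine tsum_congr fun w => ?_
  simp only [hW, hD]
  ring

end Multiplication

/-! ### Monotone weights in the `m`-particle spaces -/

section Sectors

variable {S : Type*}

/-- The `m`-particle space as a subspace of `ℓ²(Sᵐ)`. -/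
def sectorIncl (S : Type*) (m : ℕ) : Sector S m →L[ℂ] lp (fun _ : Fin m → S => ℂ) 2 :=
  (symmFun S m).subtypeL

theorem hasDerivAt_sectorEvol (Λ : Set S) (J : Λ → Λ → ℂ) (g μ : ℝ) (m : ℕ) (φ : Sector S m)
    (t : ℝ) : HasDerivAt (fun u => sectorEvol Λ J g μ u m φ)
      (-Complex.I • sectorHam Λ J g μ m (sectorEvol Λ J g μ t m φ)) t := by
  have h1 : ∀ u : ℝ, (-(Complex.I * (u : ℂ))) • sectorHam Λ J g μ m =
      u • (-Complex.I • sectorHam Λ J g μ m) := fun u => by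
    rw [← Complex.coe_smul u, smul_smul]
    congr 1
    ring
  have h := (hasDerivAt_exp_smul_const' (𝕂 := ℝ) (-Complex.I • sectorHam Λ J g μ m) t)
  have h2 := (ContinuousLinearMap.apply ℂ (Sector S m) φ).restrictScalars ℝ
    |>.hasFDerivAt.comp_hasDerivAt t h
  simp only [sectorEvol, h1]
  exact h2

theorem sectorHam_toFun (Λ : Set S) (J : Λ → Λ → ℂ) (hJ : ∀ x y, J y x = star (J x y)) {B : ℝ}
    (hs : ∀ x, Summable fun y => ‖J x y‖) (hB : ∀ x, ∑' y, ‖J x y‖ ≤ B)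
    (g μ : ℝ) (m : ℕ) (φ : Sector S m) (v : Fin m → S) :
    (sectorHam Λ J g μ m φ).toFun v = ∑' w, kernel Λ J g μ m v w * φ.toFun w := by
  have h1 : sectorWave φ m = φ.toFun :=
    Pi.single_eq_same (M := fun m => (Fin m → S) → ℂ) m φ.toFun
  rw [sectorHam_apply Λ J hJ B hs hB, hamExpr_eq Λ J hs g μ m (sectorWave φ) ?_ ‖φ‖ ?_ v, h1]
  · intro σ w
    rw [h1]
    exact (show symmFun S m from φ).2 σ w
  · intro w
    rw [h1]
    exact lp.norm_apply_le_norm (by norm_num) (show symmFun S m from φ).1 w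

/-- The second quantization of the weight `f` on the sites in `Λ`. -/
def weight (Λ : Set S) (f : S → ℝ) {m : ℕ} (v : Fin m → S) : ℝ := ∑ i, Λ.indicator f (v i)

theorem abs_weight_le {Λ : Set S} {f : S → ℝ} {K : ℝ} (hK : 0 ≤ K) (hf : ∀ x ∈ Λ, |f x| ≤ K)
    {m : ℕ} (v : Fin m → S) : |weight Λ f v| ≤ m * K := by
  refine (Finset.abs_sum_le_sum_abs _ _).trans ((Finset.sum_le_card_nsmul _ _ K fun i _ => ?_).trans
    (by simp))
  by_cases h : v i ∈ Λ
  · rw [Set.indicator_of_mem h]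
    exact hf _ h
  · rwa [Set.indicator_of_notMem h, abs_zero]

theorem weight_sub_update (Λ : Set S) (f : S → ℝ) [DecidableEq S] {m : ℕ} (v : Fin m → S)
    (i : Fin m) (y : S) : weight Λ f v - weight Λ f (Function.update v i y) =
      Λ.indicator f (v i) - Λ.indicator f y := by
  unfold weight
  rw [← Finset.sum_sub_distrib, Finset.sum_eq_single i]
  · simp
  · intro j _ hj
    simp [hj]
  · simp

/-- A hop moves one particle, so the many-body variation is a sum of one-body variations. The
diagonal, which carries `g` and `μ`, meets the factor `weight Λ f v - weight Λ f v = 0`. -/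
theorem tsum_weight_mul_norm_kernel_le (Λ : Set S) (J : Λ → Λ → ℂ)
    (hs : ∀ x, Summable fun y => ‖J x y‖) {f V : S → ℝ} {K : ℝ} (hf : ∀ x, |f x| ≤ K)
    (hV : ∀ x : Λ, ∑' y : Λ, |f x - f y| * ‖J x y‖ ≤ V x) (g μ : ℝ) (m : ℕ) (v : Fin m → S) :
    ∑' w, |weight Λ f v - weight Λ f w| * ‖kernel Λ J g μ m v w‖ ≤ weight Λ V v := by
  classical
  have hhop : ∀ i, ∃ a, HasSum (fun w => |weight Λ f v - weight Λ f w| * ‖hop Λ J m i v w‖) a ∧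
      a ≤ Λ.indicator V (v i) := by
    intro i
    by_cases h : v i ∈ Λ
    · refine ⟨∑' y : Λ, |f (v i) - f y| * ‖J ⟨v i, h⟩ y‖, ?_, ?_⟩
      · refine hasSum_hop Λ J m i v (fun z w => |weight Λ f v - weight Λ f w| * ‖z‖)
          (fun w => by simp) h ?_
        simp only [weight_sub_update, Set.indicator_of_mem h, Set.indicator_of_mem (Subtype.mem _)]
        refine Summable.hasSum (Summable.of_norm_bounded ((hs ⟨v i, h⟩).mul_left (2 * K))
          fun y => ?_)
        rw [norm_mul, norm_norm, Real.norm_eq_abs, abs_abs]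
        refine mul_le_mul_of_nonneg_right ((abs_sub _ _).trans ?_) (norm_nonneg _)
        linarith [hf (v i), hf y]
      · rw [Set.indicator_of_mem h]
        exact hV ⟨v i, h⟩
    · refine ⟨0, ?_, by rw [Set.indicator_of_notMem h]⟩
      have : ∀ w, hop Λ J m i v w = 0 := fun w => dif_neg fun h' => h h'.1
      simp only [this, norm_zero, mul_zero]
      exact hasSum_zero
  choose a ha ha' using hhop
  have hle : ∀ w, |weight Λ f v - weight Λ f w| * ‖kernel Λ J g μ m v w‖ ≤
      ∑ i, |weight Λ f v - weight Λ f w| * ‖hop Λ J m i v w‖ := by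
    intro w
    by_cases hw : w = v
    · subst hw
      simp
    · rw [← Finset.mul_sum, kernel, if_neg hw, zero_sub, norm_neg]
      exact mul_le_mul_of_nonneg_left (norm_sum_le _ _) (abs_nonneg _)
  have hsum := hasSum_sum fun i (_ : i ∈ Finset.univ) => ha i
  refine ((hsum.summable.of_nonneg_of_le (fun w => by positivity) hle).tsum_le_tsum hle
    hsum.summable).trans ?_
  rw [hsum.tsum_eq]
  exact Finset.sum_le_sum fun i _ => ha' i

/-- The expectation of a time-dependent weight is decreasing if the weight decreases fast enough
to outrun the hopping. -/
theorem antitone_tsum_weight (Λ : Set S) (J : Λ → Λ → ℂ) (hJ : ∀ x y, J y x = star (J x y)) {B : ℝ}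
    (hs : ∀ x, Summable fun y => ‖J x y‖) (hB : ∀ x, ∑' y, ‖J x y‖ ≤ B) {f f' : ℝ → S → ℝ}
    {K K' C : ℝ} (hf : ∀ t x, |f t x| ≤ K) (hf' : ∀ t x, |f' t x| ≤ K')
    (hd : ∀ t u x, |f u x - f t x - f' t x * (u - t)| ≤ C * (u - t) ^ 2)
    (hV : ∀ t (x : Λ), ∑' y : Λ, |f t x - f t y| * ‖J x y‖ ≤ -f' t x)
    (g μ : ℝ) (m : ℕ) (φ : Sector S m) :
    Antitone fun t => ∑' v, weight Λ (f t) v * ‖(sectorEvol Λ J g μ t m φ).toFun v‖ ^ 2 := by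
  -- A site is needed to read off that `K`, `K'` and `C` are nonnegative.
  rcases isEmpty_or_nonempty S with hS | ⟨⟨x₀⟩⟩
  · intro t u _
    rcases m with _ | m
    · simp [weight]
    · simp
  have hK : 0 ≤ K := (abs_nonneg _).trans (hf 0 x₀)
  have hK' : 0 ≤ K' := (abs_nonneg _).trans (hf' 0 x₀)
  have hC : 0 ≤ C := by simpa using (abs_nonneg _).trans (hd 0 1 x₀)
  have hF : ∀ t (v : Fin m → S), |weight Λ (f t) v| ≤ m * K := fun t =>
    abs_weight_le hK fun x _ => hf t x
  have hF' : ∀ t (v : Fin m → S), |weight Λ (f' t) v| ≤ m * K' := fun t =>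
    abs_weight_le hK' fun x _ => hf' t x
  have hFd : ∀ t u (v : Fin m → S), |weight Λ (f u) v - weight Λ (f t) v -
      weight Λ (f' t) v * (u - t)| ≤ m * C * (u - t) ^ 2 := by
    intro t u v
    have h : weight Λ (f u) v - weight Λ (f t) v - weight Λ (f' t) v * (u - t) =
        weight Λ (fun x => f u x - f t x - f' t x * (u - t)) v := by
      unfold weight
      rw [Finset.sum_mul, ← Finset.sum_sub_distrib, ← Finset.sum_sub_distrib]
      refine Finset.sum_congr rfl fun i _ => ?_
      by_cases hi : v i ∈ Λ <;> simp [hi]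
    rw [h, mul_assoc]
    exact abs_weight_le (by positivity) (fun x _ => hd t u x) v
  let ψ : ℝ → lp (fun _ : Fin m → S => ℂ) 2 := fun t =>
    sectorIncl S m (sectorEvol Λ J g μ t m φ)
  let Hψ : ℝ → lp (fun _ : Fin m → S => ℂ) 2 := fun t =>
    sectorIncl S m (sectorHam Λ J g μ m (sectorEvol Λ J g μ t m φ))
  have hψ : ∀ t, HasDerivAt ψ (-Complex.I • Hψ t) t := fun t => by
    have := ((sectorIncl S m).restrictScalars ℝ).hasFDerivAt.comp_hasDerivAt t
      (hasDerivAt_sectorEvol Λ J g μ m φ t)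
    refine this.congr_deriv ?_
    exact map_smul (sectorIncl S m) _ _
  have hHψ : ∀ t v, Hψ t v = ∑' w, kernel Λ J g μ m v w * ψ t w := fun t v =>
    sectorHam_toFun Λ J hJ hs hB g μ m _ v
  let M : ℝ → lp (fun _ : Fin m → S => ℂ) 2 →L[ℂ] lp (fun _ : Fin m → S => ℂ) 2 := fun t =>
    mulOp (weight Λ (f t)) (m * K) (hF t)
  let M' : ℝ → lp (fun _ : Fin m → S => ℂ) 2 →L[ℂ] lp (fun _ : Fin m → S => ℂ) 2 := fun t =>
    mulOp (weight Λ (f' t)) (m * K') (hF' t)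
  have hM : ∀ t, HasDerivAt M (M' t) t := hasDerivAt_mulOp hF hF' hFd
  have hE : ∀ t, HasDerivAt (fun u => (inner ℂ (ψ u) (M u (ψ u))).re)
      ((inner ℂ (ψ t) (M' t (ψ t) + M t (-Complex.I • Hψ t))).re +
        (inner ℂ (-Complex.I • Hψ t) (M t (ψ t))).re) t := by
    intro t
    have h1 : HasDerivAt (fun u => M u (ψ u)) (M' t (ψ t) + M t (-Complex.I • Hψ t)) t := by
      have h2 := (ContinuousLinearMap.restrictScalarsL ℂ (lp (fun _ : Fin m → S => ℂ) 2)
        (lp (fun _ : Fin m → S => ℂ) 2) ℝ ℝ).hasFDerivAt.comp_hasDerivAt t (hM t)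
      exact h2.clm_apply (hψ t)
    exact Complex.reCLM.hasFDerivAt.comp_hasDerivAt t ((hψ t).inner ℂ h1)
  have hval : (fun t => ∑' v, weight Λ (f t) v * ‖(sectorEvol Λ J g μ t m φ).toFun v‖ ^ 2) =
      fun t => (inner ℂ (ψ t) (M t (ψ t))).re := funext fun t =>
    (re_inner_mulOp _ _ (hF t) (ψ t)).symm
  rw [hval]
  refine antitone_of_hasDerivAt_nonpos hE fun t => ?_
  -- This is the expectation of `i[H, dΓ(f_t)]`, written as a weighted sum of the currents `Im (ψ̄
  -- Hψ)`.
  have hcross : (inner ℂ (ψ t) (M t (-Complex.I • Hψ t))).re +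
      (inner ℂ (-Complex.I • Hψ t) (M t (ψ t))).re =
      2 * ∑' v, weight Λ (f t) v * (star (ψ t v) * ∑' w, kernel Λ J g μ m v w * ψ t w).im := by
    rw [lp.inner_eq_tsum, lp.inner_eq_tsum, Complex.re_tsum (lp.summable_inner _ _),
      Complex.re_tsum (lp.summable_inner _ _), two_mul]
    congr 1
    all_goals
      refine tsum_congr fun v => ?_
      rw [← hHψ]
      simp only [M, mulOp_apply, lp.coeFn_smul, Pi.smul_apply, RCLike.inner_apply, smul_eq_mul,
        map_mul, map_neg, Complex.conj_I, Complex.mul_re, Complex.mul_im, Complex.neg_re,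
        Complex.neg_im, Complex.I_re, Complex.I_im, Complex.ofReal_re, Complex.ofReal_im,
        Complex.conj_re, Complex.conj_im, Complex.star_def]
      ring
  have hflux := two_mul_tsum_im_le (kernel_star Λ J hJ g μ m)
    (fun v => (summable_norm_kernel Λ J B hs hB g μ m v).1)
    (fun v => (summable_norm_kernel Λ J B hs hB g μ m v).2) (hF t) (ψ t)
  have hle : ∑' v, (∑' w, |weight Λ (f t) v - weight Λ (f t) w| * ‖kernel Λ J g μ m v w‖) *
      ‖ψ t v‖ ^ 2 ≤ -∑' v, weight Λ (f' t) v * ‖ψ t v‖ ^ 2 := by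
    have hpt : ∀ v : Fin m → S, ∑' w, |weight Λ (f t) v - weight Λ (f t) w| *
        ‖kernel Λ J g μ m v w‖ ≤ -weight Λ (f' t) v := fun v => by
      refine (tsum_weight_mul_norm_kernel_le Λ J hs (hf t) (V := fun x => -f' t x) (hV t)
        g μ m v).trans_eq ?_
      unfold weight
      rw [← Finset.sum_neg_distrib]
      refine Finset.sum_congr rfl fun i _ => ?_
      by_cases hi : v i ∈ Λ <;> simp [hi]
    rw [← tsum_neg]
    have hs' := summable_mul_norm_sq (hF' t) (ψ t)
    refine Summable.tsum_le_tsum (fun v => ?_) ?_ hs'.neg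
    · rw [← neg_mul]
      exact mul_le_mul_of_nonneg_right (hpt v) (sq_nonneg _)
    · refine summable_mul_norm_sq (K := m * K') (fun v => ?_) (ψ t)
      rw [abs_of_nonneg (tsum_nonneg fun w => by positivity)]
      exact (hpt v).trans ((neg_le_abs _).trans (hF' t v))
  rw [inner_add_right, Complex.add_re, add_assoc, hcross, re_inner_mulOp, Pi.zero_apply]
  linarith

end Sectors

/-! ### Particle numbers in the `m`-particle spaces -/

section Particles

variable {S : Type*}

theorem tsum_fin_cons {n : ℕ} (F : (Fin (n + 1) → S) → ℝ≥0∞) :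
    ∑' w, F w = ∑' x, ∑' v : Fin n → S, F (Fin.cons x v) := by
  rw [← (Fin.consEquiv fun _ => S).tsum_eq, ENNReal.tsum_prod']
  rfl

theorem tsum_indicator_apply_eq {n : ℕ} (A : Set S) (F : (Fin (n + 1) → S) → ℝ≥0∞)
    (hF : ∀ (σ : Equiv.Perm (Fin (n + 1))) v, F (v ∘ σ) = F v) (i : Fin (n + 1)) :
    ∑' w, A.indicator 1 (w i) * F w = ∑' w, A.indicator 1 (w 0) * F w := by
  rw [← ((Equiv.swap 0 i).arrowCongr (Equiv.refl S)).tsum_eq]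
  refine tsum_congr fun w => ?_
  have hw : ((Equiv.swap 0 i).arrowCongr (Equiv.refl S)) w = w ∘ Equiv.swap 0 i := by
    ext j
    simp [Equiv.arrowCongr]
  rw [hw, hF, Function.comp_apply, Equiv.swap_apply_right]

/-- The expected number of particles in `A` in the state of `m` particles with wave
function `ψ`. -/
def sectorParticles (A : Set S) {m : ℕ} (ψ : Sector S m) : ℝ :=
  ∑' v, weight A 1 v * ‖ψ.toFun v‖ ^ 2

theorem weight_nonneg {Λ : Set S} {f : S → ℝ} (hf : 0 ≤ f) {m : ℕ} (v : Fin m → S) :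
    0 ≤ weight Λ f v :=
  Finset.sum_nonneg fun i _ => Set.indicator_apply_nonneg fun _ => hf (v i)

theorem sectorParticles_nonneg (A : Set S) {m : ℕ} (ψ : Sector S m) : 0 ≤ sectorParticles A ψ :=
  tsum_nonneg fun _ => mul_nonneg (weight_nonneg zero_le_one _) (sq_nonneg _)

theorem summable_weight_mul {A : Set S} {f : S → ℝ} {K : ℝ} (hK : 0 ≤ K) (hf : ∀ x, |f x| ≤ K)
    {m : ℕ} (ψ : Sector S m) : Summable fun v => weight A f v * ‖ψ.toFun v‖ ^ 2 :=
  summable_mul_norm_sq (fun v => abs_weight_le hK (fun x _ => hf x) v) (sectorIncl S m ψ)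

theorem ofReal_sectorParticles (A : Set S) {m : ℕ} (ψ : Sector S m) :
    ENNReal.ofReal (sectorParticles A ψ) =
      ∑ i : Fin m, ∑' v : Fin m → S, A.indicator 1 (v i) * ‖ψ.toFun v‖ₑ ^ 2 := by
  rw [sectorParticles, ENNReal.ofReal_tsum_of_nonneg
    (fun v => mul_nonneg (weight_nonneg zero_le_one v) (sq_nonneg _))
    (summable_weight_mul zero_le_one (fun _ => by simp) ψ),
    ← Summable.tsum_finsetSum fun i _ => ENNReal.summable]
  refine tsum_congr fun v => ?_
  rw [ENNReal.ofReal_mul (weight_nonneg zero_le_one v), weight, ENNReal.ofReal_sum_of_nonneg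
    (f := fun i => A.indicator 1 (v i)) fun i _ => Set.indicator_apply_nonneg fun _ => zero_le_one,
    Finset.sum_mul]
  refine Finset.sum_congr rfl fun i _ => ?_
  rw [ENNReal.ofReal_pow (norm_nonneg _), ofReal_norm]
  by_cases h : v i ∈ A <;> simp [h]

/-- By symmetry each of the `n + 1` particles contributes as much as particle 0, and `n + 1` is the
square of the factor in `annih`. -/
theorem ofReal_sectorParticles_succ (A : Set S) {n : ℕ} (ψ : Sector S (n + 1)) :
    ENNReal.ofReal (sectorParticles A ψ) = ∑' x : A, ∑' v : Fin n → S,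
      ‖((√((n : ℝ) + 1) : ℝ) : ℂ) * ψ.toFun (Fin.cons (x : S) v)‖ₑ ^ 2 := by
  have hperm : ∀ (σ : Equiv.Perm (Fin (n + 1))) v,
      ‖ψ.toFun (v ∘ σ)‖ₑ ^ 2 = ‖ψ.toFun v‖ₑ ^ 2 := fun σ v => by
    congr 2
    exact (show symmFun S (n + 1) from ψ).2 σ v
  rw [ofReal_sectorParticles, Finset.sum_congr rfl fun i _ =>
    tsum_indicator_apply_eq A (fun v => ‖ψ.toFun v‖ₑ ^ 2) hperm i, Finset.sum_const,
    Finset.card_univ, Fintype.card_fin, tsum_fin_cons, nsmul_eq_mul, ← ENNReal.tsum_mul_left,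
    tsum_subtype A fun x =>
      ∑' v : Fin n → S, ‖((√((n : ℝ) + 1) : ℝ) : ℂ) * ψ.toFun (Fin.cons x v)‖ₑ ^ 2]
  refine tsum_congr fun x => ?_
  by_cases hx : x ∈ A
  · rw [Set.indicator_of_mem hx, ← ENNReal.tsum_mul_left]
    refine tsum_congr fun v => ?_
    have h : ‖((√((n : ℝ) + 1) : ℝ) : ℂ)‖ₑ ^ 2 = ((n + 1 : ℕ) : ℝ≥0∞) := by
      rw [← ofReal_norm, ← ENNReal.ofReal_pow (norm_nonneg _), Complex.norm_real, Real.norm_eq_abs,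
        sq_abs, Real.sq_sqrt (by positivity), ← Nat.cast_succ, ENNReal.ofReal_natCast]
    rw [enorm_mul, mul_pow, h]
    simp [hx]
  · simp [hx]

theorem particles_eq_tsum (A : Set S) (φ : Fock S) :
    particles A φ = ∑' m, ENNReal.ofReal (sectorParticles A (φ m)) := by
  -- Annihilation lowers the degree, so term `n` of `particles` comes from sector `n + 1`; sector 0
  -- contributes nothing.
  rw [tsum_eq_zero_add' ENNReal.summable, particles, ENNReal.tsum_comm, ofReal_sectorParticles,
    Finset.univ_eq_empty, Finset.sum_empty, zero_add]
  exact tsum_congr fun n => (ofReal_sectorParticles_succ A _).symm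

theorem sectorEvol_zero (Λ : Set S) (J : Λ → Λ → ℂ) (g μ : ℝ) (m : ℕ) :
    sectorEvol Λ J g μ 0 m = 1 := by
  simp [sectorEvol, NormedSpace.exp_zero]

theorem sectorParticles_mono {A A' : Set S} (h : A ⊆ A') {m : ℕ} (ψ : Sector S m) :
    sectorParticles A ψ ≤ sectorParticles A' ψ := by
  refine (summable_weight_mul zero_le_one (fun _ => by simp) ψ).tsum_le_tsum (fun v => ?_)
    (summable_weight_mul zero_le_one (fun _ => by simp) ψ)
  refine mul_le_mul_of_nonneg_right (Finset.sum_le_sum fun i _ => ?_) (sq_nonneg _)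
  exact Set.indicator_le_indicator_of_subset h (fun _ => zero_le_one) _

/-! ### Propagation estimate for a moving front -/

section Evolution

variable {Λ : Set S} {J : Λ → Λ → ℂ} (hJ : ∀ x y, J y x = star (J x y)) {B : ℝ}
  (hs : ∀ x, Summable fun y => ‖J x y‖) (hB : ∀ x, ∑' y, ‖J x y‖ ≤ B)

include hJ hs hB

/-- Hopping within `Λ` does not vary the constant weight 1, so it may serve as its own decreasing
weight. -/
theorem sectorParticles_sectorEvol_le (g μ : ℝ) {t : ℝ} (ht : 0 ≤ t) {m : ℕ} (φ : Sector S m) :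
    sectorParticles Λ (sectorEvol Λ J g μ t m φ) ≤ sectorParticles Λ φ := by
  have h := antitone_tsum_weight Λ J hJ hs hB (f := fun _ => 1) (f' := fun _ => 0) (K := 1)
    (K' := 0) (C := 0) (by simp) (by simp) (by simp) (by simp) g μ m φ ht
  simpa [sectorEvol_zero, sectorParticles] using h

theorem particles_evol_le (g μ : ℝ) {t : ℝ} (ht : 0 ≤ t) {A : Set S} (hA : A ⊆ Λ) (φ : Fock S) :
    particles A (evol Λ J g μ t φ) ≤ particles Λ φ := by
  rw [particles_eq_tsum, particles_eq_tsum]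
  exact ENNReal.tsum_le_tsum fun m => ENNReal.ofReal_le_ofReal
    ((sectorParticles_mono hA _).trans (sectorParticles_sectorEvol_le hJ hs hB g μ ht (φ m)))

/-- Particles that have moved past the front `h = c t + α` must have started at `h > -α`, up to
a polynomially small error. -/
theorem exists_particles_evol_le_add [PseudoMetricSpace S] {q : ℕ} (hq : 1 ≤ q) {κ κ' c : ℝ}
    (hκ : ∀ x : Λ, (Summable fun y : Λ => ‖J x y‖ * dist (x : S) y) ∧
      ∑' y : Λ, ‖J x y‖ * dist (x : S) y ≤ κ)
    (hκ' : ∀ x : Λ, (Summable fun y : Λ => ‖J x y‖ * dist (x : S) y ^ (q + 1)) ∧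
      ∑' y : Λ, ‖J x y‖ * dist (x : S) y ^ (q + 1) ≤ κ')
    (hκ0 : 0 ≤ κ) (hc : κ < c) :
    ∃ s : ℝ, 0 < s ∧ ∀ (h : S → ℝ) (_ : ∀ x y, |h x - h y| ≤ dist x y) (g μ t α : ℝ) (_ : 0 ≤ t)
      (_ : 0 ≤ α) (A A₀ : Set S) (_ : A ⊆ Λ) (_ : ∀ x ∈ A, c * t + α ≤ h x)
      (_ : ∀ x ∈ Λ, -α < h x → x ∈ A₀) (φ : Fock S),
      particles A (evol Λ J g μ t φ) ≤
        particles A₀ φ + ENNReal.ofReal ((1 + α / s) ^ q)⁻¹ * particles Λ φ := by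
  have hc0 : 0 < c := hκ0.trans_lt hc
  -- Half of the gap `c - κ` pays for `εκ`, the other half for the higher moment through the choice
  -- of `s`; `κ + 1` avoids dividing by 0.
  set ε := (c - κ) / (2 * (κ + 1)) with hε
  have hε0 : 0 < ε := div_pos (by linarith) (by positivity)
  obtain ⟨K, hK0, hK⟩ := exists_abs_profile_sub_le hq hε0
  have hgap : (1 + ε) * κ ≤ (c + κ) / 2 := by
    have : ε * κ ≤ (c - κ) / 2 := by
      rw [hε, div_mul_eq_mul_div, div_le_div_iff₀ (by positivity) two_pos]
      nlinarith
    linarith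
  set s := max 1 (2 * (K * |κ'|) / (c - κ)) with hs_def
  have hs1 : 1 ≤ s := le_max_left _ _
  have hs0 : 0 < s := by linarith
  have hsK : K * |κ'| ≤ s * ((c - κ) / 2) := by
    have := le_max_right 1 (2 * (K * |κ'|) / (c - κ))
    rw [← hs_def, div_le_iff₀ (by linarith)] at this
    linarith
  refine ⟨s, hs0, fun h hh g μ t α ht hα A A₀ hA hAt hA₀ φ => ?_⟩
  set f : ℝ → S → ℝ := fun t x => profile q ((h x - c * t) / s) with hf
  set f' : ℝ → S → ℝ := fun t x => -(c / s * profileDeriv q ((h x - c * t) / s)) with hf'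
  have hf1 : ∀ t x, |f t x| ≤ 1 := fun t x =>
    abs_le.2 ⟨by linarith [profile_nonneg q ((h x - c * t) / s)], profile_le_one q _⟩
  have hf'1 : ∀ t x, |f' t x| ≤ c / s * (q / 2) := fun t x => by
    rw [hf', abs_neg, abs_of_nonneg (mul_nonneg (by positivity) (profileDeriv_nonneg q _))]
    exact mul_le_mul_of_nonneg_left (profileDeriv_le q _) (by positivity)
  have hd : ∀ t u x, |f u x - f t x - f' t x * (u - t)| ≤
      (q / 2 * (q + 1) * (c / s) ^ 2) * (u - t) ^ 2 := fun t u x => by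
    refine (le_of_eq ?_).trans ((abs_profile_sub_sub_le q ((h x - c * t) / s)
      ((h x - c * u) / s)).trans_eq ?_)
    · simp only [hf, hf']
      congr 1
      field_simp
      ring
    · field_simp
      ring
  -- Both sides carry the factor `γ / s`; what remains is `(1 + ε)κ + K κ' / s^q ≤ c`, where `s ≥ 1`
  -- and `q ≥ 1` allow `s^q` to be replaced by `s`.
  have hV : ∀ t (x : Λ), ∑' y : Λ, |f t x - f t y| * ‖J x y‖ ≤ -f' t x := by
    intro t x
    have hg := profileDeriv_nonneg q ((h x - c * t) / s)
    set γ := profileDeriv q ((h x - c * t) / s) with hγ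
    have hpt : ∀ y : Λ, |f t x - f t y| * ‖J x y‖ ≤
        γ * ((1 + ε) / s) * (‖J x y‖ * dist (x : S) y) +
          γ * (K / s ^ (q + 1)) * (‖J x y‖ * dist (x : S) y ^ (q + 1)) := by
      intro y
      have h1 : |(h x - c * t) / s - (h y - c * t) / s| ≤ dist (x : S) y / s := by
        rw [← sub_div, abs_div, abs_of_pos hs0, sub_sub_sub_cancel_right]
        exact div_le_div_of_nonneg_right (hh x y) hs0.le
      calc |f t x - f t y| * ‖J x y‖ ≤ γ * ((1 + ε) * (dist (x : S) y / s) +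
            K * (dist (x : S) y / s) ^ (q + 1)) * ‖J x y‖ := by
            refine mul_le_mul_of_nonneg_right ((hK _ _).trans ?_) (norm_nonneg _)
            rw [← hγ]
            gcongr
        _ = _ := by
            rw [div_pow]
            ring
    have hsum := ((hκ x).1.mul_left (γ * ((1 + ε) / s))).add
      ((hκ' x).1.mul_left (γ * (K / s ^ (q + 1))))
    refine ((hsum.of_nonneg_of_le (fun y => by positivity) hpt).tsum_le_tsum hpt hsum).trans ?_
    rw [((hκ x).1.mul_left _).tsum_add ((hκ' x).1.mul_left _), tsum_mul_left, tsum_mul_left]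
    have h2 : K / s ^ (q + 1) * ∑' y : Λ, ‖J x y‖ * dist (x : S) y ^ (q + 1) ≤
        (c - κ) / 2 / s := by
      calc K / s ^ (q + 1) * ∑' y : Λ, ‖J x y‖ * dist (x : S) y ^ (q + 1)
          ≤ K / s ^ (q + 1) * |κ'| :=
            mul_le_mul_of_nonneg_left ((hκ' x).2.trans (le_abs_self κ')) (by positivity)
        _ ≤ K / s ^ 2 * |κ'| := by
            have : 2 ≤ q + 1 := Nat.succ_le_succ hq
            gcongr
        _ ≤ (c - κ) / 2 / s := by
            rw [div_mul_eq_mul_div, div_le_div_iff₀ (by positivity) hs0]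
            nlinarith
    have h3 : (1 + ε) / s * ∑' y : Λ, ‖J x y‖ * dist (x : S) y ≤ (c + κ) / 2 / s := by
      rw [div_mul_eq_mul_div]
      refine div_le_div_of_nonneg_right (le_trans ?_ hgap) hs0.le
      exact mul_le_mul_of_nonneg_left (hκ x).2 (by positivity)
    have h4 : -f' t x = γ * ((c + κ) / 2 / s + (c - κ) / 2 / s) := by
      simp only [hf', hγ]
      ring
    rw [h4, mul_assoc, mul_assoc, ← mul_add]
    exact mul_le_mul_of_nonneg_left (add_le_add h3 h2) hg
  -- The size of either tail at distance `α` from the front: `f t ≥ 1 - τ` on `A`, and `f 0 ≤ τ` on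
  -- the part of `Λ` outside `A₀`. Each use costs `τ` times the particle number.
  set τ := profile q (-(α / s)) with hτ
  have hτ2 : 2 * τ = ((1 + α / s) ^ q)⁻¹ := by
    rw [hτ, profile_of_nonpos q (neg_nonpos.2 (by positivity)), sub_neg_eq_add]
    ring
  have hτ0 : 0 ≤ τ := profile_nonneg q _
  have hweight : ∀ {A A' : Set S} {k k' : S → ℝ} {C C' : ℝ} {m : ℕ} (ψ : Sector S m),
      0 ≤ C → 0 ≤ C' → (∀ x, |k x| ≤ C) → (∀ x, |k' x| ≤ C') →
      (∀ x, A.indicator k x ≤ A'.indicator k' x + τ * Λ.indicator 1 x) →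
      ∑' v, weight A k v * ‖ψ.toFun v‖ ^ 2 ≤
        ∑' v, weight A' k' v * ‖ψ.toFun v‖ ^ 2 + τ * sectorParticles Λ ψ := by
    intro A A' k k' C C' m ψ hC hC' hk hk' hle
    have h1 := summable_weight_mul (A := A') hC' hk' ψ
    have h2 := (summable_weight_mul (A := Λ) (f := 1) zero_le_one (fun _ => by simp) ψ).mul_left τ
    rw [sectorParticles, ← tsum_mul_left, ← h1.tsum_add h2]
    refine (summable_weight_mul hC hk ψ).tsum_le_tsum (fun v => ?_) (h1.add h2)
    rw [← mul_assoc, ← add_mul]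
    refine mul_le_mul_of_nonneg_right ?_ (sq_nonneg _)
    unfold weight
    rw [Finset.mul_sum, ← Finset.sum_add_distrib]
    exact Finset.sum_le_sum fun i _ => hle (v i)
  have hsector : ∀ m, sectorParticles A (sectorEvol Λ J g μ t m (φ m)) ≤
      sectorParticles A₀ (φ m) + ((1 + α / s) ^ q)⁻¹ * sectorParticles Λ (φ m) := by
    intro m
    have h1 := hweight (A := A) (A' := Λ) (k := 1) (k' := f t)
      (sectorEvol Λ J g μ t m (φ m)) zero_le_one zero_le_one (fun _ => by simp) (hf1 t) fun x => by
        by_cases hx : x ∈ A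
        · have h2 : 1 - τ ≤ f t x := by
            rw [hτ, profile_neg, sub_sub_cancel]
            refine monotone_profile q (div_le_div_of_nonneg_right ?_ hs0.le)
            linarith [hAt x hx]
          simp only [hx, hA hx, Set.indicator_of_mem, Pi.one_apply]
          linarith
        · rw [Set.indicator_of_notMem hx]
          exact add_nonneg (Set.indicator_apply_nonneg fun _ => profile_nonneg q _)
            (mul_nonneg hτ0 (Set.indicator_apply_nonneg fun _ => zero_le_one))
    have h2 := antitone_tsum_weight Λ J hJ hs hB hf1 hf'1 hd hV g μ m (φ m) ht
    have h3 := hweight (A := Λ) (A' := A₀) (k := f 0) (k' := 1) (φ m) zero_le_one zero_le_one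
      (hf1 0) (fun _ => by simp) fun x => by
        by_cases hx : x ∈ Λ
        · by_cases hx' : x ∈ A₀
          · simp only [hx, hx', Set.indicator_of_mem, Pi.one_apply]
            linarith [(abs_le.1 (hf1 0 x)).2]
          · have h4 : f 0 x ≤ τ := by
              rw [hτ, ← neg_div]
              refine monotone_profile q (div_le_div_of_nonneg_right ?_ hs0.le)
              have := not_lt.1 fun h5 => hx' (hA₀ x hx h5)
              linarith
            simp only [hx, hx', Set.indicator_of_mem, Pi.one_apply, Set.indicator_of_notMem,
              not_false_eq_true]
            linarith
        · rw [Set.indicator_of_notMem hx]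
          exact add_nonneg (Set.indicator_apply_nonneg fun _ => zero_le_one)
            (mul_nonneg hτ0 (Set.indicator_apply_nonneg fun _ => zero_le_one))
    have h4 := mul_le_mul_of_nonneg_left (sectorParticles_sectorEvol_le hJ hs hB g μ ht (φ m)) hτ0
    simp only [sectorEvol_zero, one_apply_eq_self] at h2
    rw [← hτ2]
    calc sectorParticles A (sectorEvol Λ J g μ t m (φ m)) ≤ _ := h1
      _ ≤ _ := add_le_add (h2.trans h3) h4
      _ = sectorParticles A₀ (φ m) + τ * sectorParticles Λ (φ m) +
          τ * sectorParticles Λ (φ m) := rfl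
      _ = _ := by ring
  rw [particles_eq_tsum, particles_eq_tsum, particles_eq_tsum, ← ENNReal.tsum_mul_left,
    ← ENNReal.tsum_add]
  refine ENNReal.tsum_le_tsum fun m => ?_
  rw [← ENNReal.ofReal_mul (by positivity), ← ENNReal.ofReal_add (sectorParticles_nonneg _ _)
    (mul_nonneg (by positivity) (sectorParticles_nonneg _ _))]
  exact ENNReal.ofReal_le_ofReal (hsector m)

end Evolution

end Particles

end

end BoseHubbard

namespace BoseHubbard

/-! ### Moments of the hopping matrix -/

theorem summable_and_tsum_le_of_kappa_lt_top {S : Type*} [PseudoMetricSpace S] {Λ : Set S}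
    {J : Λ → Λ → ℂ} {q : ℕ} (h : kappa Λ J q < ∞) (x : Λ) :
    (Summable fun y : Λ => ‖J x y‖ * dist (x : S) y ^ q) ∧
      ∑' y : Λ, ‖J x y‖ * dist (x : S) y ^ q ≤ (kappa Λ J q).toReal := by
  have hx : ∑' y : Λ, ‖J x y‖ₑ * edist (x : S) (y : S) ^ q ≤ kappa Λ J q :=
    le_iSup (fun x : Λ => ∑' y : Λ, ‖J x y‖ₑ * edist (x : S) (y : S) ^ q) x
  have hne := (hx.trans_lt h).ne
  have hterm : ∀ y : Λ, (‖J x y‖ₑ * edist (x : S) (y : S) ^ q).toReal =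
      ‖J x y‖ * dist (x : S) y ^ q := fun y => by
    rw [ENNReal.toReal_mul, ENNReal.toReal_pow, toReal_enorm, dist_edist]
  constructor
  · simpa only [hterm] using ENNReal.summable_toReal hne
  · simp only [← hterm]
    rw [← ENNReal.tsum_toReal_eq (ENNReal.ne_top_of_tsum_ne_top hne)]
    exact ENNReal.toReal_mono h.ne hx

/-- In a uniformly discrete set of sites, a finite first moment and a bounded diagonal give
bounded row sums. -/
theorem summable_and_tsum_norm_le {S : Type*} [MetricSpace S] {Λ : Set S} {J : Λ → Λ → ℂ}
    {δ M κ : ℝ} (hδ : 0 < δ) (hS : ∀ x y : S, x ≠ y → δ ≤ dist x y) (hM : ∀ x, ‖J x x‖ ≤ M)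
    (hκ : ∀ x : Λ, (Summable fun y : Λ => ‖J x y‖ * dist (x : S) y) ∧
      ∑' y : Λ, ‖J x y‖ * dist (x : S) y ≤ κ) (x : Λ) :
    (Summable fun y => ‖J x y‖) ∧ ∑' y, ‖J x y‖ ≤ M + δ⁻¹ * κ := by
  classical
  have h1 := (hasSum_ite_eq x M).add ((hκ x).1.hasSum.mul_left δ⁻¹)
  have hle : ∀ y, ‖J x y‖ ≤ (if y = x then M else 0) + δ⁻¹ * (‖J x y‖ * dist (x : S) y) := by
    intro y
    by_cases h : y = x
    · subst h
      simpa using hM y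
    · rw [if_neg h, zero_add, mul_left_comm]
      refine le_mul_of_one_le_right (norm_nonneg _) ?_
      rw [inv_mul_eq_div, one_le_div hδ]
      exact hS x y fun h' => h (Subtype.ext h'.symm)
  have hs := h1.summable.of_nonneg_of_le (fun y => norm_nonneg _) hle
  refine ⟨hs, (hs.tsum_le_tsum hle h1.summable).trans ?_⟩
  rw [h1.tsum_eq]
  gcongr
  exact (hκ x).2

end BoseHubbard

/-! ### The two propagation bounds -/

open BoseHubbard in
theorem theorem2 {d : ℕ} (L : Submodule ℤ (EuclideanSpace ℝ (Fin d)))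
    [DiscreteTopology L] [IsZLattice ℝ L] (Λ : Set L) (J : Λ → Λ → ℂ)
    (hJ : ∀ x y : Λ, J y x = star (J x y))
    (hdiag : ∃ M : ℝ, ∀ x : Λ, ‖J x x‖ ≤ M)
    (p : ℕ) (hp : 1 ≤ p) (hκ : kappa Λ J p < ∞)
    (c : ℝ) (hc : kappa Λ J 1 < ENNReal.ofReal c)
    (n : ℕ) (hn : n ≤ p - 1)
    (B θ : ℝ) (hB : 0 < B) (hθ : 0 < θ) (hθ' : θ < 1) :
    ∃ C : ℝ, 0 < C ∧
      ∀ (g μ : ℝ) (_ : 0 < g) (φ : Fock L) (_ : MemDomSqrtN Λ φ)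
        (b t ρ : ℝ) (_ : 0 < b) (_ : b ≤ max B (θ * ρ)) (_ : 0 < t) (_ : b + c * t < ρ),
        particles {x : L | x ∈ Λ ∧ ρ < ‖x‖} (evol Λ J g μ t φ) ≤
            particles {x : L | x ∈ Λ ∧ b < ‖x‖} φ
              + ENNReal.ofReal (C * (ρ ^ n)⁻¹) * particles Λ φ ∧
        particles {x : L | x ∈ Λ ∧ ‖x‖ < b} (evol Λ J g μ t φ) ≤
            particles {x : L | x ∈ Λ ∧ ‖x‖ < ρ} φ
              + ENNReal.ofReal (C * (ρ ^ n)⁻¹) * particles Λ φ := by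
  obtain ⟨M, hM⟩ := hdiag
  have hc0 : 0 < c := ENNReal.ofReal_pos.1 (bot_le.trans_lt hc)
  have hκ₁ : ∀ x : Λ, (Summable fun y : Λ => ‖J x y‖ * dist (x : L) y) ∧
      ∑' y : Λ, ‖J x y‖ * dist (x : L) y ≤ (kappa Λ J 1).toReal := by
    simpa only [pow_one] using
      summable_and_tsum_le_of_kappa_lt_top (hc.trans ENNReal.ofReal_lt_top)
  have hκc : (kappa Λ J 1).toReal < c :=
    (ENNReal.lt_ofReal_iff_toReal_lt (hc.trans ENNReal.ofReal_lt_top).ne).1 hc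
  have hκ0 : 0 ≤ (kappa Λ J 1).toReal := ENNReal.toReal_nonneg
  -- In a discrete group the separation at 0 is the same at every point, by translation.
  obtain ⟨δ, hδ, hL⟩ : ∃ δ > 0, ∀ x y : L, x ≠ y → δ ≤ dist x y := by
    obtain ⟨δ, hδ, h⟩ := Metric.isOpen_singleton_iff.1 (isOpen_discrete ({0} : Set L))
    refine ⟨δ, hδ, fun x y hxy => not_lt.1 fun hlt => hxy (sub_eq_zero.1 (h _ ?_))⟩
    rwa [dist_zero_right, ← dist_eq_norm]
  have hrow := summable_and_tsum_norm_le hδ hL hM hκ₁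
  have hs := fun x => (hrow x).1
  have hbd := fun x => (hrow x).2
  have htrivial : ∀ {C ρ : ℝ}, 1 ≤ C * (ρ ^ n)⁻¹ → ∀ (g μ t : ℝ), 0 < t →
      ∀ (φ : Fock L) (A A₀ : Set L), A ⊆ Λ → particles A (evol Λ J g μ t φ) ≤
        particles A₀ φ + ENNReal.ofReal (C * (ρ ^ n)⁻¹) * particles Λ φ := by
    intro C ρ hC g μ t ht φ A A₀ hA
    refine (particles_evol_le hJ hs hbd g μ ht.le hA φ).trans (le_add_left ?_)
    exact le_mul_of_one_le_left' (ENNReal.one_le_ofReal.2 hC)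
  rcases Nat.eq_zero_or_pos n with rfl | hn0
  -- For `n = 0` particle conservation is enough. The front argument needs `q = p - 1 ≥ 1`, which `0
  -- < n ≤ p - 1` provides.
  · refine ⟨1, one_pos, fun g μ _ φ _ b t ρ _ _ ht _ => ⟨?_, ?_⟩⟩ <;>
      exact htrivial (by simp) g μ t ht φ _ _ fun x hx => hx.1
  -- The front moves at `c' < c`, so that `ρ > b + c t` leaves room proportional to `ρ - b`.
  obtain ⟨c', hκc', hc'⟩ := exists_between hκc
  obtain ⟨q, rfl⟩ : ∃ q, p = q + 1 := ⟨p - 1, by omega⟩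
  have hnq : n ≤ q := hn
  obtain ⟨s, hs0, hfront⟩ := exists_particles_evol_le_add hJ hs hbd (hn0.trans_le hnq) hκ₁
    (summable_and_tsum_le_of_kappa_lt_top hκ) hκ0 hκc'
  have hc'0 : 0 < c' := hκ0.trans_lt hκc'
  have hcc : 0 < 1 - c' / c := sub_pos.2 ((div_lt_one hc0).2 hc')
  obtain ⟨ϑ, hϑ, hϑ1⟩ : ∃ ϑ, max 2⁻¹ θ = ϑ ∧ ϑ < 1 :=
    ⟨_, rfl, max_lt (by norm_num) hθ'⟩
  set η := (1 - c' / c) * (1 - ϑ) / 2 with hη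
  have hη0 : 0 < η := by
    have := sub_pos.2 hϑ1
    positivity
  -- The first summand covers `ρ < 2B`, where the error term already exceeds the particle number;
  -- the second is the tail of the profile at distance `ηρ`. For `ρ ≥ 2B`, `B ≤ ρ / 2` explains the
  -- `2⁻¹` in `ϑ`.
  refine ⟨(2 * B) ^ n + (s / η) ^ n, by positivity, fun g μ _ φ _ b t ρ hb hbB ht hρ => ?_⟩
  have hct : 0 < c * t := mul_pos hc0 ht
  have hρ0 : 0 < ρ := by linarith
  rcases lt_or_ge ρ (2 * B) with hρB | hρB
  · have h1 : 1 ≤ ((2 * B) ^ n + (s / η) ^ n) * (ρ ^ n)⁻¹ := by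
      rw [← div_eq_mul_inv, one_le_div (by positivity)]
      have h2 : ρ ^ n ≤ (2 * B) ^ n := by gcongr
      have h3 : 0 ≤ (s / η) ^ n := by positivity
      linarith
    constructor <;> exact htrivial h1 g μ t ht φ _ _ fun x hx => hx.1
  · have hbϑ : b ≤ ϑ * ρ := by
      have h1 : 2⁻¹ * ρ ≤ ϑ * ρ := mul_le_mul_of_nonneg_right (hϑ ▸ le_max_left _ _) hρ0.le
      have h2 : θ * ρ ≤ ϑ * ρ := mul_le_mul_of_nonneg_right (hϑ ▸ le_max_right _ _) hρ0.le
      exact hbB.trans (max_le (by linarith) h2)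
    -- The room is split evenly: a margin `ηρ` on each side of the front.
    have hα : 2 * (η * ρ) ≤ ρ - b - c' * t := by
      have h1 : c' * t ≤ c' / c * (ρ - b) := by
        rw [div_mul_eq_mul_div, le_div_iff₀ hc0]
        nlinarith
      have h2 : (1 - c' / c) * ((1 - ϑ) * ρ) ≤ (1 - c' / c) * (ρ - b) :=
        mul_le_mul_of_nonneg_left (by linarith) hcc.le
      have h3 : 2 * (η * ρ) = (1 - c' / c) * ((1 - ϑ) * ρ) := by
        rw [hη]
        ring
      linarith
    have hα0 : 0 ≤ η * ρ := by positivity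
    have herr : ((1 + η * ρ / s) ^ q)⁻¹ ≤ ((2 * B) ^ n + (s / η) ^ n) * (ρ ^ n)⁻¹ := by
      have h1 : 1 ≤ 1 + η * ρ / s := le_add_of_nonneg_right (by positivity)
      calc ((1 + η * ρ / s) ^ q)⁻¹ ≤ ((1 + η * ρ / s) ^ n)⁻¹ := by gcongr
        _ ≤ ((η * ρ / s) ^ n)⁻¹ := by
          gcongr
          linarith
        _ = (s / η) ^ n * (ρ ^ n)⁻¹ := by
          rw [← inv_pow, ← inv_pow, ← mul_pow]
          congr 1
          field_simp
        _ ≤ _ := by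
          gcongr
          exact le_add_of_nonneg_left (by positivity)
    have herr' : ∀ N : ℝ≥0∞, ENNReal.ofReal ((1 + η * ρ / s) ^ q)⁻¹ * N ≤
        ENNReal.ofReal (((2 * B) ^ n + (s / η) ^ n) * (ρ ^ n)⁻¹) * N := fun N =>
      mul_le_mul_left (ENNReal.ofReal_le_ofReal herr) N
    have hnorm : ∀ x y : L, |‖x‖ - ‖y‖| ≤ dist x y := fun x y => by
      rw [dist_eq_norm]
      exact abs_norm_sub_norm_le x y
    constructor
    · refine (hfront (fun x => ‖x‖ - b - η * ρ) (fun x y => ?_) g μ t (η * ρ) ht.le hα0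
        _ {x : L | x ∈ Λ ∧ b < ‖x‖} (fun x hx => hx.1) (fun x hx => ?_) (fun x hx h => ?_)
        φ).trans (add_le_add_right (herr' _) _)
      · rw [sub_sub_sub_cancel_right, sub_sub_sub_cancel_right]
        exact hnorm x y
      · have := hx.2
        linarith
      · exact ⟨hx, by linarith⟩
    · refine (hfront (fun x => ρ - η * ρ - ‖x‖) (fun x y => ?_) g μ t (η * ρ) ht.le hα0
        _ {x : L | x ∈ Λ ∧ ‖x‖ < ρ} (fun x hx => hx.1) (fun x hx => ?_) (fun x hx h => ?_)
        φ).trans (add_le_add_right (herr' _) _)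
      · rw [sub_sub_sub_cancel_left, abs_sub_comm]
        exact hnorm x y
      · have := hx.2
        linarith
      · exact ⟨hx, by linarith⟩
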